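/- For $\ell\in\mathbb N=\{0,1,2,\dots\}$, a binary sequence of length $\ell$ is a doubly infinite sequence $f=(f_j)_{j\in\mathbb Z}$ of complex numbers with $f_j\in\{1,-1\}$ for $0\le j<\ell$ and $f_j=0$ for all other $j$. For $s\in\mathbb Z$ let $C_f(s)=\sum_{j\in\mathbb Z} f_{j+s}\overline{f_j}$, and put \[ \mathrm{ssac}(f)=\sum_{s\in\mathbb Z}|C_f(s)|^2,\qquad \mathrm{ADF}(f)=\frac{\sum_{s\in\mathbb Z,\,s\neq 0}|C_f(s)|^2}{C_f(0)^2}\quad(\text{for } f\ne 0). \] Let $\mathbb E^\ell$ denote the expected value when $f$ is uniformly distributed over the $2^\ell$ binary sequences of length $\ell$, and for a real-valued function $v$ of $f$ write $\mu_p^\ell v=\mathbb E^\ell\big(v(f)-\mathbb E^\ell v(f)\big)^p$ for the $p$th central moment and $\tilde\mu_p^\ell v=\mu_p^\ell v/(\mu_2^\ell v)^{p/2}$ for the $p$th standardized moment. (1) For every $\ell\in\mathbb N$, \[ \mu_3^\ell\,\mathrm{ssac}=\begin{cases} 160\ell^4-1296\ell^3+3296\ell^2-2496\ell & \text{if }\ell\equiv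 0\pmod 4,\\ 160\ell^4-1296\ell^3+3296\ell^2-2736\ell+576 & \text{if }\ell\equiv \pm1\pmod 4,\\ 160\ell^4-1296\ell^3+3296\ell^2-2496\ell-384 & \text{if }\ell\equiv 2\pmod 4. \end{cases} \] (2) For every integer $\ell\ge 1$, \[ \mu_3^\ell\,\mathrm{ADF}=\begin{cases} \dfrac{160\ell^4-1296\ell^3+3296\ell^2-2496\ell}{\ell^6} & \text{if }\ell\equiv 0\pmod 4,\\[6pt] \dfrac{160\ell^4-1296\ell^3+3296\ell^2-2736\ell+576}{\ell^6} & \text{if }\ell\equiv \pm1\pmod 4,\\[6pt] \dfrac{160\ell^4-1296\ell^3+3296\ell^2-2496\ell-384}{\ell^6} & \text{if }\ell\equiv 2\pmod 4. \end{cases} \] (3) For every integer $\ell\ge 1$, each of the variances $\mu_2^\ell\,\mathrm{ADF}$ and $\mu_2^\ell\,\mathrm{ssac}$ is positive if and only if $\ell\ge 3$, and \[ \tilde\mu_3^\ell\,\mathrm{ADF}=\tilde\mu_3^\ell\,\mathrm{ssac}=\begin{cases} \dfrac{6\sqrt3\,(10\ell^4-81\ell^3+206\ell^2-156\ell)}{(4\ell^3-15\ell^2+14\ell)^{3/2}}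 & \text{if }\ell\equiv 0\pmod 4,\\[8pt] \dfrac{6\sqrt3\,(10\ell^4-81\ell^3+206\ell^2-171\ell+36)}{(4\ell^3-15\ell^2+14\ell-3)^{3/2}} & \text{if }\ell\equiv \pm1\pmod 4,\\[8pt] \dfrac{6\sqrt3\,(10\ell^4-81\ell^3+206\ell^2-156\ell-24)}{(4\ell^3-15\ell^2+14\ell)^{3/2}} & \text{if }\ell\equiv 2\pmod 4, \end{cases} \] where for $\ell\in\{1,2\}$ all these quotients have the form $0/0$, which is read as $0$. -/

import Mathlib

namespace DemeritFactor

/-- The aperiodic autocorrelation of `f` at shift `s`, `C_f(s) = ∑_{j ∈ ℤ} f_{j+s} * conj f_j`,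
for a doubly infinite complex sequence `f` with finitely many nonzero terms. -/
noncomputable def autocorr (f : ℤ → ℂ) (s : ℤ) : ℂ :=
  ∑ᶠ j : ℤ, f (j + s) * starRingEnd ℂ (f j)

/-- The sum over all shifts of the squared magnitudes of the autocorrelation values. -/
noncomputable def ssac (f : ℤ → ℂ) : ℝ :=
  ∑ᶠ s : ℤ, ‖autocorr f s‖ ^ 2

/-- The autocorrelation demerit factor of a nonzero sequence. The value `C_f(0)` is the squared
Euclidean norm of `f`, a nonnegative real number, so it equals its own absolute value. -/
noncomputable def ADF (f : ℤ → ℂ) : ℝ :=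
  (∑ᶠ (s : ℤ) (_ : s ≠ 0), ‖autocorr f s‖ ^ 2) / ‖autocorr f 0‖ ^ 2

/-- The binary sequences of length `ℓ`: the entries at positions `0, …, ℓ - 1` are `1` or `-1`,
all other entries are `0`. -/
def binarySeqs (ℓ : ℕ) : Set (ℤ → ℂ) :=
  {f | ∀ j : ℤ, (0 ≤ j ∧ j < ℓ → f j = 1 ∨ f j = -1) ∧ (¬ (0 ≤ j ∧ j < ℓ) → f j = 0)}

theorem binarySeqs_finite (ℓ : ℕ) : (binarySeqs ℓ).Finite := by
  have key : Set.InjOn (fun (f : ℤ → ℂ) (i : Fin ℓ) => f (i : ℕ)) (binarySeqs ℓ) := by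
    intro f hf g hg h
    funext j
    by_cases hj : 0 ≤ j ∧ j < ℓ
    · have h1 := congrFun h ⟨j.toNat, by omega⟩
      have h2 : ((j.toNat : ℕ) : ℤ) = j := Int.toNat_of_nonneg hj.1
      simpa [h2] using h1
    · rw [(hf j).2 hj, (hg j).2 hj]
  refine Set.Finite.of_finite_image ?_ key
  refine (Set.Finite.pi' (t := fun _ : Fin ℓ => ({1, -1} : Set ℂ)) fun _ => by simp).subset ?_
  rintro _ ⟨f, hf, rfl⟩ i
  exact (hf (i : ℕ)).1 ⟨by omega, by have := i.2; omega⟩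

/-- The expected value of `v f`, for `f` uniformly distributed over the binary sequences of
length `ℓ`. -/
noncomputable def expectation (ℓ : ℕ) (v : (ℤ → ℂ) → ℝ) : ℝ :=
  (∑ f ∈ (binarySeqs_finite ℓ).toFinset, v f) / ((binarySeqs_finite ℓ).toFinset.card : ℝ)

/-- The `p`th central moment of `v f`, for `f` uniformly distributed over the binary sequences
of length `ℓ`. -/
noncomputable def centralMoment (p ℓ : ℕ) (v : (ℤ → ℂ) → ℝ) : ℝ :=
  expectation ℓ fun f => (v f - expectation ℓ v) ^ p

/-- The `p`th standardized moment (for `p = 3`, the skewness) of `v f`, for `f` uniformly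
distributed over the binary sequences of length `ℓ`. -/
noncomputable def standardizedMoment (p ℓ : ℕ) (v : (ℤ → ℂ) → ℝ) : ℝ :=
  centralMoment p ℓ v / centralMoment 2 ℓ v ^ ((p : ℝ) / 2)

end DemeritFactor

/-!
On binary sequences the products `∏ j ∈ S, f_j` are Walsh characters: they multiply by symmetric
difference of the index sets, and all but the one of the empty set have mean zero. Expanding the
squared autocorrelations gives `ssac = const + 4 * (∑_{A ∈ P} f_A + 2 * ∑_{A ∈ Q} f_A)`, where `P`
consists of the two-element sets of equal parity and `Q` of the parallelograms
`{x, x + u, x + v, x + u + v}` in `{0, …, ℓ - 1}`. So the variance counts the members of `P` and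
`Q`, and the third moment counts the pairs `(A, B)` whose symmetric difference is again a member.

Such a pair amounts to three disjoint sets `A ∩ B`, `A \ B`, `B \ A` any two of which have their
union in the family, that is, to a triangle of the relation "disjoint with union in the family". Two
disjoint pairs form a parallelogram if and only if they have the same sum or the same difference,
and since a pair is determined by its sum and its difference, a triangle uses only one of the two.
Counting triangles inside the classes of constant sum and constant difference gives
quasi-polynomials in `ℓ`. Finally `ADF = ssac / ℓ ^ 2 - 1`, which carries the moments over.
-/

namespace DemeritFactor

open Finset

/-! ### Walsh characters -/

theorem binarySeqs_apply_eq_ofReal_re {ℓ : ℕ} {f : ℤ → ℂ} (hf : f ∈ binarySeqs ℓ) (j : ℤ) :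
    f j = ((f j).re : ℂ) := by
  by_cases hj : 0 ≤ j ∧ j < ℓ
  · rcases (hf j).1 hj with h | h <;> simp [h]
  · simp [(hf j).2 hj]

theorem binarySeqs_re_mul_self {ℓ : ℕ} {f : ℤ → ℂ} (hf : f ∈ binarySeqs ℓ) {j : ℕ}
    (hj : j < ℓ) : (f j).re * (f j).re = 1 := by
  rcases (hf j).1 ⟨by omega, by omega⟩ with h | h <;> simp [h]

theorem binarySeqs_nonempty (ℓ : ℕ) : (binarySeqs ℓ).Nonempty :=
  ⟨fun j => if 0 ≤ j ∧ j < ℓ then 1 else 0, fun _ =>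
    ⟨fun h => Or.inl (if_pos h), fun h => if_neg h⟩⟩

theorem expectation_congr {ℓ : ℕ} {v w : (ℤ → ℂ) → ℝ} (h : ∀ f ∈ binarySeqs ℓ, v f = w f) :
    expectation ℓ v = expectation ℓ w := by
  unfold expectation
  rw [sum_congr rfl fun f hf => h f ((Set.Finite.mem_toFinset _).1 hf)]

theorem expectation_const (ℓ : ℕ) (c : ℝ) : expectation ℓ (fun _ => c) = c := by
  have hcard : ((binarySeqs_finite ℓ).toFinset.card : ℝ) ≠ 0 := by
    rw [Nat.cast_ne_zero, card_ne_zero, Set.Finite.toFinset_nonempty]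
    exact binarySeqs_nonempty ℓ
  rw [expectation, sum_const, nsmul_eq_mul, mul_div_cancel_left₀ _ hcard]

theorem expectation_add (ℓ : ℕ) (v w : (ℤ → ℂ) → ℝ) :
    expectation ℓ (fun f => v f + w f) = expectation ℓ v + expectation ℓ w := by
  simp only [expectation, sum_add_distrib, add_div]

theorem expectation_const_mul (ℓ : ℕ) (c : ℝ) (v : (ℤ → ℂ) → ℝ) :
    expectation ℓ (fun f => c * v f) = c * expectation ℓ v := by
  simp only [expectation, ← mul_sum, mul_div_assoc]

theorem expectation_sum {ι : Type*} (ℓ : ℕ) (s : Finset ι) (v : ι → (ℤ → ℂ) → ℝ) :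
    expectation ℓ (fun f => ∑ i ∈ s, v i f) = ∑ i ∈ s, expectation ℓ (v i) := by
  simp only [expectation, sum_div]
  exact sum_comm

/-- The Walsh character `∏ j ∈ S, f_j` of a real sequence `f`. -/
noncomputable def walsh (S : Finset ℕ) (f : ℤ → ℂ) : ℝ := ∏ j ∈ S, (f j).re

theorem walsh_mul_walsh {ℓ : ℕ} {f : ℤ → ℂ} (hf : f ∈ binarySeqs ℓ) {A : Finset ℕ}
    (hA : A ⊆ range ℓ) (B : Finset ℕ) : walsh A f * walsh B f = walsh (symmDiff A B) f := by
  have hleft : walsh A f = walsh (A \ B) f * walsh (A ∩ B) f := by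
    unfold walsh
    rw [← prod_union (disjoint_sdiff_inter A B), sdiff_union_inter]
  have hright : walsh B f = walsh (B \ A) f * walsh (A ∩ B) f := by
    unfold walsh
    rw [inter_comm, ← prod_union (disjoint_sdiff_inter B A), sdiff_union_inter]
  have hsymm : walsh (symmDiff A B) f = walsh (A \ B) f * walsh (B \ A) f := by
    unfold walsh
    rw [symmDiff_def, sup_eq_union, prod_union disjoint_sdiff_sdiff]
  have hinter : walsh (A ∩ B) f * walsh (A ∩ B) f = 1 := by
    unfold walsh
    rw [← prod_mul_distrib]
    exact prod_eq_one fun j hj =>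
      binarySeqs_re_mul_self hf (mem_range.1 (hA (mem_inter.1 hj).1))
  rw [hleft, hright, hsymm]
  linear_combination (walsh (A \ B) f * walsh (B \ A) f) * hinter

/-- The sequence `f` with its entry at position `i` negated. -/
def negateAt (i : ℕ) (f : ℤ → ℂ) : ℤ → ℂ := fun j => if j = i then -f j else f j

theorem negateAt_negateAt (i : ℕ) (f : ℤ → ℂ) : negateAt i (negateAt i f) = f := by
  funext j
  unfold negateAt
  split_ifs <;> simp

theorem negateAt_mem_binarySeqs {ℓ : ℕ} {f : ℤ → ℂ} (hf : f ∈ binarySeqs ℓ) (i : ℕ) :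
    negateAt i f ∈ binarySeqs ℓ := by
  intro j
  unfold negateAt
  refine ⟨fun hj => ?_, fun hj => by simp [(hf j).2 hj]⟩
  rcases (hf j).1 hj with h | h <;> split_ifs <;> simp [h]

theorem walsh_negateAt {S : Finset ℕ} {i : ℕ} (hi : i ∈ S) (f : ℤ → ℂ) :
    walsh S (negateAt i f) = -walsh S f := by
  have hrest : ∏ j ∈ S.erase i, (negateAt i f j).re = ∏ j ∈ S.erase i, (f j).re :=
    prod_congr rfl fun j hj => by simp [negateAt, ne_of_mem_erase hj]
  rw [walsh, walsh, ← mul_prod_erase S _ hi, ← mul_prod_erase S (fun j => (f j).re) hi, hrest]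
  simp [negateAt]

theorem expectation_comp_negateAt (ℓ i : ℕ) (v : (ℤ → ℂ) → ℝ) :
    expectation ℓ (fun f => v (negateAt i f)) = expectation ℓ v := by
  have hmem : ∀ f ∈ (binarySeqs_finite ℓ).toFinset,
      negateAt i f ∈ (binarySeqs_finite ℓ).toFinset := by
    simp only [Set.Finite.mem_toFinset]
    exact fun f hf => negateAt_mem_binarySeqs hf i
  unfold expectation
  rw [sum_bij' (fun f _ => negateAt i f) (fun f _ => negateAt i f) hmem hmem
    (fun f _ => negateAt_negateAt i f) (fun f _ => negateAt_negateAt i f) fun _ _ => rfl]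

theorem expectation_walsh (ℓ : ℕ) (S : Finset ℕ) :
    expectation ℓ (walsh S) = if S = ∅ then 1 else 0 := by
  split_ifs with hS
  · subst hS
    exact (expectation_congr fun f _ => by simp [walsh]).trans (expectation_const ℓ 1)
  · obtain ⟨i, hi⟩ := nonempty_iff_ne_empty.2 hS
    have hneg : expectation ℓ (walsh S) = -1 * expectation ℓ (walsh S) := by
      rw [← expectation_const_mul, ← expectation_comp_negateAt ℓ i]
      simp only [walsh_negateAt hi, neg_one_mul]
    linarith

/-- The sum of the Walsh characters indexed by a family of sets. -/
noncomputable def walshSum (F : Finset (Finset ℕ)) (f : ℤ → ℂ) : ℝ := ∑ A ∈ F, walsh A f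

theorem expectation_walshSum (ℓ : ℕ) {F : Finset (Finset ℕ)} (hF : ∅ ∉ F) :
    expectation ℓ (walshSum F) = 0 := by
  unfold walshSum
  rw [expectation_sum]
  refine sum_eq_zero fun A hA => ?_
  rw [expectation_walsh, if_neg (ne_of_mem_of_not_mem hA hF)]

theorem expectation_walshSum_mul_walshSum {ℓ : ℕ} {F : Finset (Finset ℕ)}
    (hF : ∀ A ∈ F, A ⊆ range ℓ) (G : Finset (Finset ℕ)) :
    expectation ℓ (fun f => walshSum F f * walshSum G f) = #(F ∩ G) := by
  have hexpand : ∀ f ∈ binarySeqs ℓ, walshSum F f * walshSum G f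
      = ∑ A ∈ F, ∑ B ∈ G, walsh (symmDiff A B) f := by
    intro f hf
    rw [walshSum, walshSum, sum_mul_sum]
    exact sum_congr rfl fun A hA => sum_congr rfl fun B _ => walsh_mul_walsh hf (hF A hA) B
  rw [expectation_congr hexpand, expectation_sum]
  simp_rw [expectation_sum, expectation_walsh]
  rw [← filter_mem_eq_inter, card_filter, Nat.cast_sum]
  refine sum_congr rfl fun A _ => ?_
  have hempty : ∀ B : Finset ℕ, symmDiff A B = ∅ ↔ A = B := fun B => symmDiff_eq_bot
  simp [hempty]

/-- The pairs of a member of `F` and a member of `G` whose symmetric difference lies in `H`. -/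
def symmDiffPairs {α : Type*} [DecidableEq α] (F G H : Finset (Finset α)) :
    Finset (Finset α × Finset α) :=
  {p ∈ F ×ˢ G | symmDiff p.1 p.2 ∈ H}

theorem expectation_walshSum_mul_walshSum_mul_walshSum {ℓ : ℕ} {F G : Finset (Finset ℕ)}
    (hF : ∀ A ∈ F, A ⊆ range ℓ) (hG : ∀ B ∈ G, B ⊆ range ℓ) (H : Finset (Finset ℕ)) :
    expectation ℓ (fun f => walshSum F f * walshSum G f * walshSum H f)
      = #(symmDiffPairs F G H) := by
  have hexpand : ∀ f ∈ binarySeqs ℓ, walshSum F f * walshSum G f * walshSum H f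
      = ∑ p ∈ F ×ˢ G, ∑ C ∈ H, walsh (symmDiff (symmDiff p.1 p.2) C) f := by
    intro f hf
    rw [walshSum, walshSum, walshSum, sum_mul_sum, ← sum_product', sum_mul_sum]
    refine sum_congr rfl fun p hp => sum_congr rfl fun C _ => ?_
    obtain ⟨hp₁, hp₂⟩ := mem_product.1 hp
    rw [walsh_mul_walsh hf (hF _ hp₁), walsh_mul_walsh hf]
    exact symmDiff_le_sup.trans (union_subset (hF _ hp₁) (hG _ hp₂))
  rw [expectation_congr hexpand, expectation_sum]
  simp_rw [expectation_sum, expectation_walsh]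
  rw [symmDiffPairs, card_filter, Nat.cast_sum]
  refine sum_congr rfl fun p _ => ?_
  have hempty : ∀ C : Finset ℕ, symmDiff (symmDiff p.1 p.2) C = ∅ ↔ symmDiff p.1 p.2 = C :=
    fun C => symmDiff_eq_bot
  simp [hempty]

/-! ### The autocorrelation sum as a Walsh sum -/

theorem autocorr_natCast {ℓ : ℕ} {f : ℤ → ℂ} (hf : f ∈ binarySeqs ℓ) (s : ℕ) :
    autocorr f s = ((∑ a ∈ range (ℓ - s), (f a).re * (f (a + s : ℕ)).re : ℝ) : ℂ) := by
  have hsupp : (Function.support fun j : ℤ => f (j + s) * starRingEnd ℂ (f j))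
      ⊆ ((range (ℓ - s)).map Nat.castEmbedding : Finset ℤ) := by
    intro j hj
    rw [Function.mem_support] at hj
    have hleft : 0 ≤ j ∧ j < ℓ := by
      by_contra h
      exact hj (by simp [(hf j).2 h])
    have hright : 0 ≤ j + s ∧ j + s < ℓ := by
      by_contra h
      exact hj (by simp [(hf (j + s)).2 h])
    simp only [coe_map, Set.mem_image, mem_coe, mem_range, Nat.castEmbedding_apply]
    exact ⟨j.toNat, by omega, by omega⟩
  rw [autocorr, finsum_eq_sum_of_support_subset _ hsupp, sum_map, Complex.ofReal_sum]
  refine sum_congr rfl fun a _ => ?_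
  rw [Nat.castEmbedding_apply, Complex.ofReal_mul, ← binarySeqs_apply_eq_ofReal_re hf,
    ← binarySeqs_apply_eq_ofReal_re hf, binarySeqs_apply_eq_ofReal_re hf a, Complex.conj_ofReal,
    mul_comm, Nat.cast_add]

theorem norm_autocorr_neg (f : ℤ → ℂ) (s : ℤ) : ‖autocorr f (-s)‖ = ‖autocorr f s‖ := by
  have hconj : autocorr f (-s) = starRingEnd ℂ (autocorr f s) := by
    unfold autocorr
    refine (finsum_comp_equiv (Equiv.addRight s)).symm.trans ?_
    refine Eq.trans (finsum_congr fun j => ?_) (AddMonoidHom.map_finsum_of_injective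
      (starRingEnd ℂ).toAddMonoidHom star_injective _).symm
    simp [mul_comm]
  rw [hconj, RCLike.norm_conj]

theorem autocorr_zero {ℓ : ℕ} {f : ℤ → ℂ} (hf : f ∈ binarySeqs ℓ) : autocorr f 0 = ℓ := by
  have hsum := autocorr_natCast hf 0
  rw [Nat.cast_zero] at hsum
  rw [hsum, sum_congr rfl (g := fun _ => (1 : ℝ))]
  · simp
  · exact fun a ha => binarySeqs_re_mul_self hf (by simpa using ha)

theorem norm_autocorr_eq_zero {ℓ : ℕ} {f : ℤ → ℂ} (hf : f ∈ binarySeqs ℓ) {s : ℤ}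
    (hs : ℓ ≤ s.natAbs) : ‖autocorr f s‖ = 0 := by
  have hzero : autocorr f s.natAbs = 0 := by
    rw [autocorr_natCast hf, Nat.sub_eq_zero_of_le hs]
    simp
  rcases Int.natAbs_eq s with h | h
  · rw [h, hzero, norm_zero]
  · rw [h, norm_autocorr_neg, hzero, norm_zero]

theorem support_norm_autocorr_sq_subset {ℓ : ℕ} {f : ℤ → ℂ} (hf : f ∈ binarySeqs ℓ) :
    (Function.support fun s : ℤ => ‖autocorr f s‖ ^ 2) ⊆ Set.Ioo (-ℓ : ℤ) ℓ := by
  intro s hs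
  have hlt : ¬ ℓ ≤ s.natAbs := fun h => hs (by simp [norm_autocorr_eq_zero hf h])
  rw [Set.mem_Ioo]
  omega

theorem finsum_int_eq_of_even {M : Type*} [AddCommMonoid M] {g : ℤ → M} {ℓ : ℕ}
    (heven : ∀ s, g (-s) = g s) (hsupp : Function.support g ⊆ Set.Ioo (-ℓ : ℤ) ℓ) :
    ∑ᶠ s, g s = g 0 + 2 • ∑ s ∈ range ℓ, g (s + 1 : ℕ) := by
  have hdisj : Disjoint ((range (ℓ + 1)).image fun s : ℕ => (s : ℤ))
      ((range ℓ).image fun s : ℕ => -((s + 1 : ℕ) : ℤ)) := by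
    simp only [disjoint_left, mem_image, mem_range]
    rintro z ⟨a, -, rfl⟩ ⟨b, -, hb⟩
    omega
  have hcover : Function.support g ⊆ ((range (ℓ + 1)).image (fun s : ℕ => (s : ℤ)) ∪
      (range ℓ).image fun s : ℕ => -((s + 1 : ℕ) : ℤ) : Finset ℤ) := by
    intro s hs
    obtain ⟨hlo, hhi⟩ := hsupp hs
    simp only [coe_union, coe_image, Set.mem_union, Set.mem_image, mem_coe, mem_range]
    rcases le_or_gt 0 s with h | h
    · exact Or.inl ⟨s.toNat, by omega, by omega⟩
    · exact Or.inr ⟨(-s - 1).toNat, by omega, by omega⟩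
  rw [finsum_eq_sum_of_support_subset g hcover, sum_union hdisj,
    sum_image fun a _ b _ h => Nat.cast_injective h,
    sum_image fun a _ b _ h => by simpa using h, sum_range_succ']
  simp only [heven, Nat.cast_zero]
  rw [two_nsmul, add_right_comm, add_comm]

theorem ssac_eq_sum_range {ℓ : ℕ} {f : ℤ → ℂ} (hf : f ∈ binarySeqs ℓ) :
    ssac f = (ℓ : ℝ) ^ 2 + 2 * ∑ s ∈ range ℓ,
      (∑ a ∈ range (ℓ - (s + 1)), (f a).re * (f (a + (s + 1) : ℕ)).re) ^ 2 := by
  rw [ssac, finsum_int_eq_of_even (fun s => by rw [norm_autocorr_neg])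
    (support_norm_autocorr_sq_subset hf), autocorr_zero hf, Complex.norm_natCast,
    nsmul_eq_mul, Nat.cast_ofNat]
  simp only [autocorr_natCast hf, Complex.norm_real, Real.norm_eq_abs, sq_abs]

theorem ADF_eq {ℓ : ℕ} {f : ℤ → ℂ} (hf : f ∈ binarySeqs ℓ) :
    ADF f = (ssac f - (ℓ : ℝ) ^ 2) / (ℓ : ℝ) ^ 2 := by
  have hsplit := add_finsum_cond_ne (f := fun s : ℤ => ‖autocorr f s‖ ^ 2) 0
    ((Set.finite_Ioo _ _).subset (support_norm_autocorr_sq_subset hf))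
  rw [autocorr_zero hf, Complex.norm_natCast] at hsplit
  rw [ADF, ssac, autocorr_zero hf, Complex.norm_natCast, ← hsplit, add_sub_cancel_left]

theorem sq_sum_range {R : Type*} [CommSemiring R] (y : ℕ → R) (n : ℕ) :
    (∑ a ∈ range n, y a) ^ 2
      = ∑ a ∈ range n, y a ^ 2 + 2 * ∑ b ∈ range n, ∑ a ∈ range b, y a * y b := by
  induction n with
  | zero => simp
  | succ n ih =>
    simp only [sum_range_succ, ← sum_mul, add_sq, ih]
    ring

/-- The triples `(x, u, v)` with `u` and `v` positive and `x + u + v < ℓ`. They serve as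
coordinates both for the parallelograms `{x, x + u, x + v, x + u + v}` and for the three-element
sets `{x, x + u, x + u + v}` in `range ℓ`. -/
def gapTriples (ℓ : ℕ) : Finset (ℕ × ℕ × ℕ) :=
  {t ∈ range ℓ ×ˢ range ℓ ×ˢ range ℓ | 0 < t.2.1 ∧ 0 < t.2.2 ∧ t.1 + t.2.1 + t.2.2 < ℓ}

theorem mem_gapTriples {ℓ x u v : ℕ} :
    (x, u, v) ∈ gapTriples ℓ ↔ 0 < u ∧ 0 < v ∧ x + u + v < ℓ := by
  simp only [gapTriples, mem_filter, mem_product, mem_range]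
  omega

theorem sum_range_eq_sum_gapTriples {M : Type*} [AddCommMonoid M] (ℓ : ℕ) (g : ℕ → ℕ → ℕ → M) :
    ∑ s ∈ range ℓ, ∑ b ∈ range (ℓ - (s + 1)), ∑ a ∈ range b, g a (s + 1) (b - a)
      = ∑ t ∈ gapTriples ℓ, g t.1 t.2.1 t.2.2 := by
  simp_rw [sum_sigma']
  refine sum_bij' (fun x _ => (x.2.2, x.1 + 1, x.2.1 - x.2.2))
    (fun t _ => ⟨t.2.1 - 1, t.1 + t.2.2, t.1⟩) ?_ ?_ ?_ ?_ fun _ _ => rfl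
  · rintro ⟨s, b, a⟩ h
    simp only [mem_sigma, mem_range, mem_gapTriples] at h ⊢
    omega
  · rintro ⟨x, u, v⟩ h
    simp only [mem_sigma, mem_range, mem_gapTriples] at h ⊢
    omega
  · rintro ⟨s, b, a⟩ h
    simp only [mem_sigma, mem_range] at h
    simp [show a + (b - a) = b by omega]
  · rintro ⟨x, u, v⟩ h
    rw [mem_gapTriples] at h
    simp [show u - 1 + 1 = u by omega]

/-- The two-element subsets of `range ℓ` whose elements have the same parity, given as the
extremes `x` and `x + 2 * u` of a degenerate parallelogram. -/
def evenPairs (ℓ : ℕ) : Finset (Finset ℕ) :=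
  {t ∈ gapTriples ℓ | t.2.1 = t.2.2}.image fun t => {t.1, t.1 + t.2.1 + t.2.2}

/-- The four-element subsets of `range ℓ` of the form `{x, x + u, x + v, x + u + v}`. -/
def quads (ℓ : ℕ) : Finset (Finset ℕ) :=
  {t ∈ gapTriples ℓ | t.2.1 < t.2.2}.image fun t =>
    {t.1, t.1 + t.2.1, t.1 + t.2.2, t.1 + t.2.1 + t.2.2}

theorem evenPair_injOn (ℓ : ℕ) :
    Set.InjOn (fun t : ℕ × ℕ × ℕ => ({t.1, t.1 + t.2.1 + t.2.2} : Finset ℕ))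
      {t ∈ gapTriples ℓ | t.2.1 = t.2.2} := by
  rintro ⟨x, u, v⟩ h ⟨x', u', v'⟩ h' heq
  simp only [Set.mem_ofPred_eq, mem_gapTriples] at h h'
  have key : ∀ y, y ∈ ({x, x + u + v} : Finset ℕ) ↔ y ∈ ({x', x' + u' + v'} : Finset ℕ) :=
    Finset.ext_iff.1 heq
  simp only [mem_insert, mem_singleton] at key
  have mem_x' := (key x').2 (by simp)
  have mem_xuv := (key (x + u + v)).1 (by simp)
  have mem_xuv' := (key (x' + u' + v')).2 (by simp)
  simp only [Prod.mk.injEq]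
  omega

theorem quad_injOn (ℓ : ℕ) :
    Set.InjOn (fun t : ℕ × ℕ × ℕ =>
      ({t.1, t.1 + t.2.1, t.1 + t.2.2, t.1 + t.2.1 + t.2.2} : Finset ℕ))
      {t ∈ gapTriples ℓ | t.2.1 < t.2.2} := by
  rintro ⟨x, u, v⟩ h ⟨x', u', v'⟩ h' heq
  simp only [Set.mem_ofPred_eq, mem_gapTriples] at h h'
  have key : ∀ y, y ∈ ({x, x + u, x + v, x + u + v} : Finset ℕ)
      ↔ y ∈ ({x', x' + u', x' + v', x' + u' + v'} : Finset ℕ) := Finset.ext_iff.1 heq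
  simp only [mem_insert, mem_singleton] at key
  have mem_x := (key x).1 (by simp)
  have mem_x' := (key x').2 (by simp)
  have mem_xuv := (key (x + u + v)).1 (by simp)
  have mem_xuv' := (key (x' + u' + v')).2 (by simp)
  have mem_xu := (key (x + u)).1 (by simp)
  have hx : x = x' := by omega
  simp only [Prod.mk.injEq]
  omega

theorem sum_gapTriples_filter_gt {M : Type*} [AddCommMonoid M] (ℓ : ℕ) (g : ℕ → ℕ → ℕ → M)
    (hg : ∀ x u v, g x u v = g x v u) :
    ∑ t ∈ gapTriples ℓ with t.2.2 < t.2.1, g t.1 t.2.1 t.2.2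
      = ∑ t ∈ gapTriples ℓ with t.2.1 < t.2.2, g t.1 t.2.1 t.2.2 := by
  refine sum_bij' (fun t _ => (t.1, t.2.2, t.2.1)) (fun t _ => (t.1, t.2.2, t.2.1))
    ?_ ?_ (fun _ _ => rfl) (fun _ _ => rfl) fun t _ => hg t.1 t.2.1 t.2.2
  all_goals
    rintro ⟨x, u, v⟩ h
    simp only [mem_filter, mem_gapTriples] at h ⊢
    omega

theorem sum_gapTriples_of_symm {M : Type*} [AddCommMonoid M] (ℓ : ℕ) (g : ℕ → ℕ → ℕ → M)
    (hg : ∀ x u v, g x u v = g x v u) :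
    ∑ t ∈ gapTriples ℓ, g t.1 t.2.1 t.2.2
      = ∑ t ∈ gapTriples ℓ with t.2.1 = t.2.2, g t.1 t.2.1 t.2.2
        + 2 • ∑ t ∈ gapTriples ℓ with t.2.1 < t.2.2, g t.1 t.2.1 t.2.2 := by
  have hsplit : ∑ t ∈ gapTriples ℓ, g t.1 t.2.1 t.2.2
      = ∑ t ∈ gapTriples ℓ with t.2.1 = t.2.2, g t.1 t.2.1 t.2.2
        + ∑ t ∈ gapTriples ℓ with t.2.1 < t.2.2, g t.1 t.2.1 t.2.2
        + ∑ t ∈ gapTriples ℓ with t.2.2 < t.2.1, g t.1 t.2.1 t.2.2 := by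
    simp_rw [sum_filter, ← sum_add_distrib]
    refine sum_congr rfl fun t _ => ?_
    rcases lt_trichotomy t.2.1 t.2.2 with h | h | h
    · simp [h, h.ne, h.not_gt]
    · simp [h]
    · simp [h, h.ne', h.not_gt]
  rw [hsplit, sum_gapTriples_filter_gt ℓ g hg, add_assoc, two_nsmul]

theorem walshSum_evenPairs {ℓ : ℕ} {f : ℤ → ℂ} (hf : f ∈ binarySeqs ℓ) :
    walshSum (evenPairs ℓ) f = ∑ t ∈ gapTriples ℓ with t.2.1 = t.2.2,
      (f t.1).re * (f (t.1 + t.2.1 : ℕ)).re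
        * ((f (t.1 + t.2.2 : ℕ)).re * (f (t.1 + t.2.1 + t.2.2 : ℕ)).re) := by
  rw [walshSum, evenPairs, sum_image (by simpa using evenPair_injOn ℓ)]
  refine sum_congr rfl ?_
  rintro ⟨x, u, v⟩ ht
  simp only [mem_filter, mem_gapTriples] at ht
  obtain ⟨ht, rfl⟩ := ht
  have hne : x ≠ x + u + u := by omega
  rw [walsh, prod_pair hne]
  linear_combination (-(f x).re * (f (x + u + u : ℕ)).re)
    * binarySeqs_re_mul_self hf (j := x + u) (by omega)

theorem walshSum_quads (ℓ : ℕ) (f : ℤ → ℂ) :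
    walshSum (quads ℓ) f = ∑ t ∈ gapTriples ℓ with t.2.1 < t.2.2,
      (f t.1).re * (f (t.1 + t.2.1 : ℕ)).re
        * ((f (t.1 + t.2.2 : ℕ)).re * (f (t.1 + t.2.1 + t.2.2 : ℕ)).re) := by
  rw [walshSum, quads, sum_image (by simpa using quad_injOn ℓ)]
  refine sum_congr rfl ?_
  rintro ⟨x, u, v⟩ ht
  simp only [mem_filter, mem_gapTriples] at ht
  rw [walsh, prod_insert, prod_insert, prod_pair, mul_assoc] <;>
    (simp only [mem_insert, mem_singleton]; omega)

theorem sq_sum_range_mul_shift {ℓ : ℕ} {f : ℤ → ℂ} (hf : f ∈ binarySeqs ℓ) (s : ℕ) :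
    (∑ a ∈ range (ℓ - s), (f a).re * (f (a + s : ℕ)).re) ^ 2
      = ((ℓ - s : ℕ) : ℝ) + 2 * ∑ b ∈ range (ℓ - s), ∑ a ∈ range b,
        (f a).re * (f (a + s : ℕ)).re
          * ((f (a + (b - a) : ℕ)).re * (f (a + s + (b - a) : ℕ)).re) := by
  have hdiag : ∀ a ∈ range (ℓ - s), ((f a).re * (f (a + s : ℕ)).re) ^ 2 = 1 := by
    intro a ha
    rw [mem_range] at ha
    rw [sq, mul_mul_mul_comm, binarySeqs_re_mul_self hf (by omega),
      binarySeqs_re_mul_self hf (by omega), one_mul]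
  rw [sq_sum_range, sum_congr rfl hdiag, sum_const, card_range, nsmul_one]
  congr 2
  refine sum_congr rfl fun b _ => sum_congr rfl fun a ha => ?_
  rw [mem_range] at ha
  rw [show a + (b - a) = b by omega, show a + s + (b - a) = b + s by omega]

theorem ssac_eq_add_walshSum {ℓ : ℕ} {f : ℤ → ℂ} (hf : f ∈ binarySeqs ℓ) :
    ssac f = ((ℓ : ℝ) ^ 2 + 2 * ∑ s ∈ range ℓ, ((ℓ - (s + 1) : ℕ) : ℝ))
      + 4 * (walshSum (evenPairs ℓ) f + 2 * walshSum (quads ℓ) f) := by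
  have hsymm : ∀ x u v : ℕ,
      (f x).re * (f (x + u : ℕ)).re * ((f (x + v : ℕ)).re * (f (x + u + v : ℕ)).re)
      = (f x).re * (f (x + v : ℕ)).re * ((f (x + u : ℕ)).re * (f (x + v + u : ℕ)).re) := by
    intro x u v
    rw [add_right_comm x v u]
    ring
  rw [ssac_eq_sum_range hf, sum_congr rfl fun s _ => sq_sum_range_mul_shift hf (s + 1),
    sum_add_distrib, ← mul_sum, sum_range_eq_sum_gapTriples ℓ fun a u v =>
      (f a).re * (f (a + u : ℕ)).re * ((f (a + v : ℕ)).re * (f (a + u + v : ℕ)).re),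
    sum_gapTriples_of_symm ℓ _ hsymm, nsmul_eq_mul, Nat.cast_ofNat, walshSum_evenPairs hf,
    walshSum_quads]
  ring

/-! ### Triangles of a relation -/

/-- `X` and `Y` are the two parts of a partition of a member of `F`. -/
abbrev Matched {α : Type*} [DecidableEq α] (F : Finset (Finset α)) (X Y : Finset α) : Prop :=
  Disjoint X Y ∧ X ∪ Y ∈ F

theorem matched_inter_sdiff {α : Type*} [DecidableEq α] {F : Finset (Finset α)} {A : Finset α}
    (hA : A ∈ F) (B : Finset α) : Matched F (A ∩ B) (A \ B) :=
  ⟨(disjoint_sdiff_inter A B).symm, by rwa [union_comm, sdiff_union_inter]⟩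

theorem symmDiff_union_union_eq_union {α : Type*} [DecidableEq α] {X Y Z : Finset α}
    (hXY : Disjoint X Y) (hXZ : Disjoint X Z) (hYZ : Disjoint Y Z) :
    symmDiff (X ∪ Y) (X ∪ Z) = Y ∪ Z := by
  grind [Finset.mem_symmDiff, disjoint_left]

theorem card_symmDiffPairs {α : Type*} [DecidableEq α] {F G H : Finset (Finset α)}
    {U : Finset α} {x y z : ℕ}
    (hF : F ⊆ powersetCard (x + y) U) (hG : G ⊆ powersetCard (x + z) U)
    (hH : H ⊆ powersetCard (y + z) U) :
    #(symmDiffPairs F G H)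
      = #{t ∈ powersetCard x U ×ˢ powersetCard y U ×ˢ powersetCard z U |
          Matched F t.1 t.2.1 ∧ Matched G t.1 t.2.2 ∧ Matched H t.2.1 t.2.2} := by
  refine card_bij' (fun p _ => (p.1 ∩ p.2, p.1 \ p.2, p.2 \ p.1))
    (fun t _ => (t.1 ∪ t.2.1, t.1 ∪ t.2.2)) ?_ ?_ ?_ ?_
  · rintro ⟨A, B⟩ h
    simp only [symmDiffPairs, mem_filter, mem_product] at h
    obtain ⟨⟨hA, hB⟩, hAB⟩ := h
    obtain ⟨hAU, hAcard⟩ := mem_powersetCard.1 (hF hA)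
    obtain ⟨hBU, hBcard⟩ := mem_powersetCard.1 (hG hB)
    have hABcard := (mem_powersetCard.1 (hH hAB)).2
    rw [symmDiff_def, sup_eq_union, card_union_of_disjoint disjoint_sdiff_sdiff] at hABcard
    have hA' := card_inter_add_card_sdiff A B
    have hB' := card_inter_add_card_sdiff B A
    rw [inter_comm] at hB'
    simp only [mem_filter, mem_product, mem_powersetCard]
    exact ⟨⟨⟨inter_subset_left.trans hAU, by omega⟩, ⟨sdiff_subset.trans hAU, by omega⟩,
      sdiff_subset.trans hBU, by omega⟩, matched_inter_sdiff hA B,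
      inter_comm B A ▸ matched_inter_sdiff hB A, disjoint_sdiff_sdiff, hAB⟩
  · rintro ⟨X, Y, Z⟩ h
    obtain ⟨-, ⟨hXY, hF'⟩, ⟨hXZ, hG'⟩, hYZ, hH'⟩ := mem_filter.1 h
    refine mem_filter.2 ⟨mem_product.2 ⟨hF', hG'⟩, ?_⟩
    rwa [symmDiff_union_union_eq_union hXY hXZ hYZ]
  · rintro ⟨A, B⟩ -
    simp only [Prod.mk.injEq]
    exact ⟨by rw [union_comm, sdiff_union_inter],
      by rw [inter_comm, union_comm, sdiff_union_inter]⟩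
  · rintro ⟨X, Y, Z⟩ h
    obtain ⟨-, ⟨hXY, -⟩, ⟨hXZ, -⟩, hYZ, -⟩ := mem_filter.1 h
    simp only [Prod.mk.injEq]
    grind [disjoint_left]

theorem symmDiff_mem_iff_matched {α : Type*} [DecidableEq α] {H : Finset (Finset α)} {y z : ℕ}
    (hH : ∀ C ∈ H, #C = y + z) {A B : Finset α} (hA : #A = y) (hB : #B = z) :
    symmDiff A B ∈ H ↔ Matched H A B := by
  constructor
  · intro h
    have hcard := hH _ h
    rw [symmDiff_def, sup_eq_union, card_union_of_disjoint disjoint_sdiff_sdiff] at hcard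
    have hA' := card_inter_add_card_sdiff A B
    have hdisj : Disjoint A B := by
      rw [disjoint_iff_inter_eq_empty, ← card_eq_zero]
      have hB' := card_inter_add_card_sdiff B A
      omega
    exact ⟨hdisj, by rwa [hdisj.symmDiff_eq_sup] at h⟩
  · rintro ⟨hdisj, h⟩
    rwa [hdisj.symmDiff_eq_sup]

section Triangles

variable {α β : Type*}

/-- The triples of elements of `S` any two of which are related by `R`, in their given order. -/
def triangles (R : α → α → Prop) [DecidableRel R] (S : Finset α) : Finset (α × α × α) :=
  {t ∈ S ×ˢ S ×ˢ S | R t.1 t.2.1 ∧ R t.1 t.2.2 ∧ R t.2.1 t.2.2}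

theorem mem_triangles {R : α → α → Prop} [DecidableRel R] {S : Finset α} {a b c : α} :
    (a, b, c) ∈ triangles R S ↔ (a ∈ S ∧ b ∈ S ∧ c ∈ S) ∧ R a b ∧ R a c ∧ R b c := by
  simp only [triangles, mem_filter, mem_product]

theorem triangles_congr {R R' : α → α → Prop} [DecidableRel R] [DecidableRel R']
    {S : Finset α} (h : ∀ a ∈ S, ∀ b ∈ S, R a b ↔ R' a b) : triangles R S = triangles R' S := by
  ext ⟨a, b, c⟩
  simp only [mem_triangles]
  grind

theorem card_triangles_image [DecidableEq β] (R : β → β → Prop) [DecidableRel R]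
    {S : Finset α} {e : α → β} (he : Set.InjOn e S) :
    #(triangles R (S.image e)) = #(triangles (fun a b => R (e a) (e b)) S) := by
  symm
  refine card_nbij (fun t => (e t.1, e t.2.1, e t.2.2)) ?_ ?_ ?_
  · rintro ⟨a, b, c⟩ h
    simp only [mem_coe, mem_triangles] at h ⊢
    exact ⟨⟨mem_image_of_mem e h.1.1, mem_image_of_mem e h.1.2.1, mem_image_of_mem e h.1.2.2⟩,
      h.2⟩
  · rintro ⟨a, b, c⟩ h ⟨a', b', c'⟩ h' heq
    simp only [mem_coe, mem_triangles, Prod.mk.injEq] at h h' heq ⊢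
    exact ⟨he h.1.1 h'.1.1 heq.1, he h.1.2.1 h'.1.2.1 heq.2.1, he h.1.2.2 h'.1.2.2 heq.2.2⟩
  · rintro ⟨a, b, c⟩ h
    simp only [mem_coe, mem_triangles, mem_image] at h
    obtain ⟨⟨⟨a, ha, rfl⟩, ⟨b, hb, rfl⟩, c, hc, rfl⟩, hR⟩ := h
    exact ⟨(a, b, c), mem_triangles.2 ⟨⟨ha, hb, hc⟩, hR⟩, rfl⟩

theorem card_filter_related_image [DecidableEq β] (R : β → β → Prop)
    [DecidableRel R] {S : Finset α} {e : α → β} (he : Set.InjOn e S) :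
    #{p ∈ S.image e ×ˢ S.image e | R p.1 p.2} = #{p ∈ S ×ˢ S | R (e p.1) (e p.2)} := by
  rw [← prodMap_image_product, filter_image, card_image_of_injOn]
  · rfl
  · exact (he.prodMap (by simpa using he)).mono (by
      rw [← coe_product]
      exact coe_subset.2 (filter_subset _ _))

theorem card_triangles_fiberwise [DecidableEq β] (R : α → α → Prop) [DecidableRel R]
    {S : Finset α} {K : Finset β} {κ : α → β} (hκ : Set.MapsTo κ S K) :
    #(triangles (fun a b => κ a = κ b ∧ R a b) S)
      = ∑ k ∈ K, #(triangles R {a ∈ S | κ a = k}) := by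
  rw [card_eq_sum_card_fiberwise (f := fun t => κ t.1) (t := K)]
  · refine sum_congr rfl fun k _ => congrArg card ?_
    ext ⟨a, b, c⟩
    simp only [mem_filter, mem_triangles]
    grind
  · rintro ⟨a, b, c⟩ h
    exact hκ (mem_triangles.1 h).1.1

theorem card_filter_related_fiberwise [DecidableEq β] (R : α → α → Prop) [DecidableRel R]
    {S : Finset α} {K : Finset β} {κ : α → β} (hκ : Set.MapsTo κ S K) :
    #{p ∈ S ×ˢ S | κ p.1 = κ p.2 ∧ R p.1 p.2}
      = ∑ k ∈ K, #{p ∈ {a ∈ S | κ a = k} ×ˢ {a ∈ S | κ a = k} | R p.1 p.2} := by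
  rw [card_eq_sum_card_fiberwise (f := fun p => κ p.1) (t := K)]
  · refine sum_congr rfl fun k _ => congrArg card ?_
    ext ⟨a, b⟩
    simp only [mem_filter, mem_product]
    grind
  · rintro ⟨a, b⟩ h
    simp only [coe_filter, mem_product, Set.mem_ofPred_eq] at h
    exact hκ h.1.1

theorem card_triangles_or (R R' : α → α → Prop) [DecidableRel R] [DecidableRel R']
    {S : Finset α} (hdisj : ∀ a ∈ S, ∀ b ∈ S, R a b → ¬ R' a b)
    (hpure : ∀ a ∈ S, ∀ b ∈ S, ∀ c ∈ S, R a b ∨ R' a b → R a c ∨ R' a c → R b c ∨ R' b c →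
      (R a b ∧ R a c ∧ R b c) ∨ (R' a b ∧ R' a c ∧ R' b c)) :
    #(triangles (fun a b => R a b ∨ R' a b) S) = #(triangles R S) + #(triangles R' S) := by
  classical
  rw [← card_union_of_disjoint]
  · congr 1
    ext ⟨a, b, c⟩
    simp only [mem_union, mem_triangles]
    grind
  · rw [disjoint_left]
    rintro ⟨a, b, c⟩ h h'
    rw [mem_triangles] at h h'
    exact hdisj a h.1.1 b h.1.2.1 h.2.1 h'.2.1

theorem sum_one_sub_mul_one_sub_mul_one_sub {A : Type*} [CommRing A] (S : Finset α)
    (N : α → α → A) (hN : ∀ a ∈ S, ∀ b ∈ S, N a b = N b a) :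
    ∑ a ∈ S, ∑ b ∈ S, ∑ c ∈ S, (1 - N a b) * (1 - N a c) * (1 - N b c)
      = (#S : A) ^ 3 - 3 * #S * ∑ a ∈ S, ∑ b ∈ S, N a b
        + 3 * ∑ a ∈ S, (∑ b ∈ S, N a b) ^ 2
        - ∑ a ∈ S, ∑ b ∈ S, ∑ c ∈ S, N a b * N a c * N b c := by
  have hexpand : ∀ a b c, (1 - N a b) * (1 - N a c) * (1 - N b c)
      = 1 - N a b - N a c - N b c + N a b * N a c + N a b * N b c + N a c * N b c
        - N a b * N a c * N b c := fun a b c => by ring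
  have hpath₁ : ∑ a ∈ S, ∑ b ∈ S, ∑ c ∈ S, N a b * N a c = ∑ a ∈ S, (∑ b ∈ S, N a b) ^ 2 :=
    sum_congr rfl fun a _ => by rw [sq, sum_mul_sum]
  have hpath₂ : ∑ a ∈ S, ∑ b ∈ S, ∑ c ∈ S, N a b * N b c = ∑ a ∈ S, (∑ b ∈ S, N a b) ^ 2 := by
    rw [sum_comm, ← hpath₁]
    exact sum_congr rfl fun b hb => sum_congr rfl fun a ha => by simp only [hN a ha b hb]
  have hpath₃ : ∑ a ∈ S, ∑ b ∈ S, ∑ c ∈ S, N a c * N b c = ∑ a ∈ S, (∑ b ∈ S, N a b) ^ 2 := by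
    rw [← hpath₂]
    refine sum_congr rfl fun a _ => ?_
    rw [sum_comm]
    exact sum_congr rfl fun c hc => sum_congr rfl fun b hb => by rw [hN b hb c hc]
  simp_rw [hexpand, sum_sub_distrib, sum_add_distrib, sum_sub_distrib, hpath₁, hpath₂, hpath₃]
  simp only [sum_const, nsmul_eq_mul, ← mul_sum]
  ring

theorem cast_card_triangles_not (N : α → α → Prop) [DecidableRel N] (S : Finset α) :
    (#(triangles (fun a b => ¬ N a b) S) : ℝ) = ∑ a ∈ S, ∑ b ∈ S, ∑ c ∈ S,
      (1 - if N a b then 1 else 0) * (1 - if N a c then 1 else 0)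
        * (1 - if N b c then 1 else 0) := by
  rw [triangles, card_filter, Nat.cast_sum, sum_product]
  simp_rw [sum_product]
  refine sum_congr rfl fun a _ => sum_congr rfl fun b _ => sum_congr rfl fun c _ => ?_
  by_cases hab : N a b <;> by_cases hac : N a c <;> by_cases hbc : N b c <;> simp [hab, hac, hbc]

theorem card_symmDiffPairs_self [DecidableEq α] {F : Finset (Finset α)}
    {U : Finset α} {x : ℕ} (hF : F ⊆ powersetCard (x + x) U) :
    #(symmDiffPairs F F F) = #(triangles (Matched F) (powersetCard x U)) :=
  card_symmDiffPairs hF hF hF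

theorem card_filter_ne [DecidableEq α] (S : Finset α) :
    (#{p ∈ S ×ˢ S | p.1 ≠ p.2} : ℝ) = #S * (#S - 1) := by
  have hoff : {p ∈ S ×ˢ S | p.1 ≠ p.2} = S.offDiag := by
    ext
    rw [mem_filter, mem_product, mem_offDiag, and_assoc]
  rw [hoff, offDiag_card, Nat.cast_sub (Nat.le_mul_self _), Nat.cast_mul]
  ring

theorem card_filter_and_not (S : Finset α) (p q : α → Prop) [DecidablePred p] [DecidablePred q] :
    (#{a ∈ S | p a ∧ ¬ q a} : ℝ) = #{a ∈ S | p a} - #{a ∈ S | p a ∧ q a} := by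
  have hsplit := card_filter_add_card_filter_not (s := {a ∈ S | p a}) q
  rw [filter_filter, filter_filter] at hsplit
  rw [← hsplit, Nat.cast_add, add_sub_cancel_left]

theorem card_triangles_ne [DecidableEq α] (S : Finset α) :
    (#(triangles (fun a b => a ≠ b) S) : ℝ) = #S * (#S - 1) * (#S - 2) := by
  rw [cast_card_triangles_not (fun a b => a = b), sum_one_sub_mul_one_sub_mul_one_sub]
  · simp only [sum_ite_eq, sum_ite_mem, inter_self, sum_const, nsmul_eq_mul, mul_one, ite_pow,
      one_pow, ne_eq, OfNat.ofNat_ne_zero, not_false_eq_true, zero_pow, mul_ite, mul_zero,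
      ↓reduceIte]
    ring
  · exact fun a _ b _ => by simp only [eq_comm]

end Triangles

/-- The pairs `{a, a + δ}` and `{b, b + δ}` meet. -/
abbrev Near (δ a b : ℕ) : Prop := a = b ∨ a = b + δ ∨ b = a + δ

theorem near_comm {δ a b : ℕ} : Near δ a b ↔ Near δ b a := by
  unfold Near
  tauto

theorem sum_range_ite_near {δ n a : ℕ} (hδ : 0 < δ) (ha : a < n) (F : ℕ → ℝ) :
    ∑ b ∈ range n, (if Near δ a b then F b else 0)
      = F a + (if δ ≤ a then F (a - δ) else 0) + (if a + δ < n then F (a + δ) else 0) := by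
  have hsplit : ∀ b, (if Near δ a b then F b else 0)
      = (if b = a then F b else 0) + (if b = a - δ then if δ ≤ a then F b else 0 else 0)
        + (if b = a + δ then F b else 0) := by
    intro b
    unfold Near
    grind
  simp_rw [hsplit, sum_add_distrib, sum_ite_eq']
  grind

theorem sum_range_ite_le (δ n : ℕ) :
    ∑ a ∈ range n, (if δ ≤ a then (1 : ℝ) else 0) = (n - δ : ℕ) := by
  rw [sum_boole, ← Nat.card_Ico δ n]
  congr 2
  ext a
  simp only [mem_filter, mem_range, mem_Ico]
  omega

theorem sum_range_ite_add_lt (δ n : ℕ) :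
    ∑ a ∈ range n, (if a + δ < n then (1 : ℝ) else 0) = (n - δ : ℕ) := by
  rw [sum_boole, ← card_range (n - δ)]
  congr 2
  ext a
  simp only [mem_filter, mem_range]
  omega

theorem sum_range_ite_le_mul_ite_add_lt (δ n : ℕ) :
    ∑ a ∈ range n, (if δ ≤ a then (1 : ℝ) else 0) * (if a + δ < n then 1 else 0)
      = (n - 2 * δ : ℕ) := by
  have hcard : n - 2 * δ = (n - δ) - δ := by omega
  simp_rw [ite_zero_mul_ite_zero, mul_one]
  rw [sum_boole, hcard, ← Nat.card_Ico δ (n - δ)]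
  congr 2
  ext a
  simp only [mem_filter, mem_range, mem_Ico]
  omega

theorem sum_range_near_degree {δ n a : ℕ} (hδ : 0 < δ) (ha : a < n) :
    ∑ b ∈ range n, (if Near δ a b then (1 : ℝ) else 0)
      = 1 + (if δ ≤ a then 1 else 0) + (if a + δ < n then 1 else 0) :=
  sum_range_ite_near hδ ha fun _ => 1

theorem sum_range_near_triangle {δ n a : ℕ} (hδ : 0 < δ) (ha : a < n) :
    ∑ b ∈ range n, ∑ c ∈ range n, (if Near δ a b then (1 : ℝ) else 0)
        * (if Near δ a c then 1 else 0) * (if Near δ b c then 1 else 0)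
      = 1 + 3 * (if δ ≤ a then 1 else 0) + 3 * (if a + δ < n then 1 else 0) := by
  have hinner : ∀ b, ∑ c ∈ range n, (if Near δ a b then (1 : ℝ) else 0)
        * (if Near δ a c then 1 else 0) * (if Near δ b c then 1 else 0)
      = if Near δ a b then (if Near δ b a then 1 else 0)
        + (if δ ≤ a then if Near δ b (a - δ) then 1 else 0 else 0)
        + (if a + δ < n then if Near δ b (a + δ) then 1 else 0 else 0) else 0 := by
    intro b
    simp only [ite_mul, one_mul, zero_mul]
    rw [sum_ite_irrel, sum_range_ite_near hδ ha, sum_const_zero]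
  simp_rw [hinner]
  rw [sum_range_ite_near hδ ha]
  unfold Near
  grind

theorem card_triangles_far {δ : ℕ} (hδ : 0 < δ) (n : ℕ) :
    (#(triangles (fun a b => ¬ Near δ a b) (range n)) : ℝ)
      = n * (n - 1) * (n - 2) - 6 * (n - δ : ℕ) * (n - 2) + 6 * (n - 2 * δ : ℕ) := by
  have hdeg : ∑ a ∈ range n, ∑ b ∈ range n, (if Near δ a b then (1 : ℝ) else 0)
      = n + 2 * (n - δ : ℕ) := by
    rw [sum_congr rfl fun a ha => sum_range_near_degree hδ (mem_range.1 ha), sum_add_distrib,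
      sum_add_distrib, sum_range_ite_le, sum_range_ite_add_lt, sum_const, card_range, nsmul_one]
    ring
  have hsq : ∑ a ∈ range n, (∑ b ∈ range n, (if Near δ a b then (1 : ℝ) else 0)) ^ 2
      = n + 6 * (n - δ : ℕ) + 2 * (n - 2 * δ : ℕ) := by
    have hterm : ∀ a ∈ range n, (∑ b ∈ range n, (if Near δ a b then (1 : ℝ) else 0)) ^ 2
        = 1 + 3 * (if δ ≤ a then 1 else 0) + 3 * (if a + δ < n then 1 else 0)
          + 2 * ((if δ ≤ a then 1 else 0) * (if a + δ < n then 1 else 0)) := by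
      intro a ha
      rw [sum_range_near_degree hδ (mem_range.1 ha)]
      split_ifs <;> norm_num
    simp_rw [sum_congr rfl hterm, sum_add_distrib, ← mul_sum, sum_range_ite_le,
      sum_range_ite_add_lt, sum_range_ite_le_mul_ite_add_lt, sum_const, card_range, nsmul_one]
    ring
  have htri : ∑ a ∈ range n, ∑ b ∈ range n, ∑ c ∈ range n, (if Near δ a b then (1 : ℝ) else 0)
        * (if Near δ a c then 1 else 0) * (if Near δ b c then 1 else 0)
      = n + 6 * (n - δ : ℕ) := by
    simp_rw [sum_congr rfl fun _ ha => sum_range_near_triangle hδ (mem_range.1 ha),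
      sum_add_distrib, ← mul_sum, sum_range_ite_le, sum_range_ite_add_lt, sum_const, card_range,
      nsmul_one]
    ring
  rw [cast_card_triangles_not, sum_one_sub_mul_one_sub_mul_one_sub, hdeg, hsq, htri, card_range]
  · ring
  · exact fun a _ b _ => by simp only [near_comm]

theorem card_pairs_far {δ : ℕ} (hδ : 0 < δ) (n : ℕ) :
    (#{p ∈ range n ×ˢ range n | ¬ Near δ p.1 p.2} : ℝ)
      = n * (n - 1) - 2 * (n - δ : ℕ) := by
  rw [← sum_boole, sum_product]
  have hdeg : ∀ a ∈ range n, ∑ b ∈ range n, (if ¬ Near δ a b then (1 : ℝ) else 0)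
      = n - (1 + (if δ ≤ a then 1 else 0) + (if a + δ < n then 1 else 0)) := by
    intro a ha
    rw [← sum_range_near_degree hδ (mem_range.1 ha), eq_sub_iff_add_eq, ← sum_add_distrib,
      sum_congr rfl (g := fun _ => (1 : ℝ)) fun b _ => by split_ifs <;> simp]
    simp
  simp_rw [sum_congr rfl hdeg, sum_sub_distrib, sum_add_distrib, sum_range_ite_le,
    sum_range_ite_add_lt, sum_const, card_range, nsmul_eq_mul]
  ring

/-! ### Pairs and parallelograms -/

theorem mem_evenPairs {ℓ : ℕ} {A : Finset ℕ} : A ∈ evenPairs ℓ ↔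
    ∃ x u, 0 < u ∧ x + 2 * u < ℓ ∧ A = {x, x + 2 * u} := by
  simp only [evenPairs, mem_image, mem_filter, Prod.exists, mem_gapTriples]
  constructor
  · rintro ⟨x, u, v, h, rfl⟩
    exact ⟨x, u, by omega, by omega, by rw [← h.2, two_mul, add_assoc]⟩
  · rintro ⟨x, u, hu, hlt, rfl⟩
    exact ⟨x, u, u, by omega, by rw [two_mul, add_assoc]⟩

theorem mem_quads {ℓ : ℕ} {q : Finset ℕ} : q ∈ quads ℓ ↔
    ∃ x u v, 0 < u ∧ u < v ∧ x + u + v < ℓ ∧ q = {x, x + u, x + v, x + u + v} := by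
  simp only [quads, mem_image, mem_filter, Prod.exists, mem_gapTriples]
  constructor
  · rintro ⟨x, u, v, h, rfl⟩
    exact ⟨x, u, v, by omega, by omega, by omega, rfl⟩
  · rintro ⟨x, u, v, hu, huv, hlt, rfl⟩
    exact ⟨x, u, v, by omega, rfl⟩

theorem evenPairs_subset_powersetCard (ℓ : ℕ) : evenPairs ℓ ⊆ powersetCard 2 (range ℓ) := by
  intro A hA
  obtain ⟨x, u, hu, hlt, rfl⟩ := mem_evenPairs.1 hA
  rw [mem_powersetCard, card_pair (by omega)]
  refine ⟨fun y hy => ?_, rfl⟩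
  simp only [mem_insert, mem_singleton] at hy
  rw [mem_range]
  omega

theorem quads_subset_powersetCard (ℓ : ℕ) : quads ℓ ⊆ powersetCard 4 (range ℓ) := by
  intro q hq
  obtain ⟨x, u, v, hu, huv, hlt, rfl⟩ := mem_quads.1 hq
  rw [mem_powersetCard]
  constructor
  · intro y hy
    simp only [mem_insert, mem_singleton] at hy
    rw [mem_range]
    omega
  · rw [card_insert_of_notMem, card_insert_of_notMem, card_pair]
    · omega
    all_goals simp only [mem_insert, mem_singleton]; omega

theorem pair_mem_evenPairs {ℓ v w : ℕ} :
    {v, w} ∈ evenPairs ℓ ↔ v < ℓ ∧ w < ℓ ∧ v ≠ w ∧ v % 2 = w % 2 := by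
  rw [mem_evenPairs]
  constructor
  · rintro ⟨x, u, hu, hlt, heq⟩
    have key := Finset.ext_iff.1 heq
    simp only [mem_insert, mem_singleton] at key
    have mem_x := (key x).2 (by simp)
    have mem_xu := (key (x + 2 * u)).2 (by simp)
    omega
  · rintro ⟨hv, hw, hvw, hmod⟩
    rcases lt_or_gt_of_ne hvw with h | h
    · exact ⟨v, (w - v) / 2, by omega, by omega, by rw [show v + 2 * ((w - v) / 2) = w by omega]⟩
    · exact ⟨w, (v - w) / 2, by omega, by omega, by
        rw [show w + 2 * ((v - w) / 2) = v by omega, pair_comm]⟩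

theorem insert_mem_quads_of_add_eq {ℓ p q r s : ℕ} (hp : p < ℓ) (hq : q < ℓ) (hr : r < ℓ)
    (hs : s < ℓ) (hpq : p ≠ q) (hrs : r ≠ s) (hpr : p ≠ r) (hps : p ≠ s) (h : p + q = r + s) :
    {p, q, r, s} ∈ quads ℓ := by
  wlog hpq' : p < q generalizing p q
  · rw [insert_comm]
    exact this hq hp hpq.symm (by omega) (by omega) (by omega) (by omega)
  wlog hrs' : r < s generalizing r s
  · rw [pair_comm r s]
    exact this hs hr hrs.symm hps hpr (by omega) (by omega)
  wlog hpr' : p < r generalizing p q r s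
  · have hperm : ({p, q, r, s} : Finset ℕ) = {r, s, p, q} := by
      ext y
      simp only [mem_insert, mem_singleton]
      tauto
    rw [hperm]
    apply this <;> omega
  rw [mem_quads]
  refine ⟨p, r - p, s - p, by omega, by omega, by omega, ?_⟩
  rw [show p + (r - p) = r by omega, show p + (s - p) = s by omega,
    show r + (s - p) = q by omega]
  ext y
  simp only [mem_insert, mem_singleton]
  tauto

theorem add_eq_add_of_insert_mem_quads {ℓ p q r s : ℕ} (hpq : p ≠ q) (hpr : p ≠ r) (hps : p ≠ s)
    (hqr : q ≠ r) (hqs : q ≠ s) (hrs : r ≠ s) (h : {p, q, r, s} ∈ quads ℓ) :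
    p + q = r + s ∨ p + r = q + s ∨ p + s = q + r := by
  obtain ⟨x, u, v, hu, huv, -, heq⟩ := mem_quads.1 h
  have key := Finset.ext_iff.1 heq
  simp only [mem_insert, mem_singleton] at key
  have hp := (key p).1 (by simp)
  have hq := (key q).1 (by simp)
  have hr := (key r).1 (by simp)
  have hs := (key s).1 (by simp)
  clear key heq
  rcases hp with rfl | rfl | rfl | rfl <;> rcases hq with rfl | rfl | rfl | rfl <;> omega

/-- The increasing pairs of elements of `range ℓ`. -/
def pairs (ℓ : ℕ) : Finset (ℕ × ℕ) := {p ∈ range ℓ ×ˢ range ℓ | p.1 < p.2}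

theorem mem_pairs {ℓ : ℕ} {p : ℕ × ℕ} : p ∈ pairs ℓ ↔ p.1 < p.2 ∧ p.2 < ℓ := by
  simp only [pairs, mem_filter, mem_product, mem_range]
  omega

theorem pair_injOn (ℓ : ℕ) :
    Set.InjOn (fun p : ℕ × ℕ => ({p.1, p.2} : Finset ℕ)) (pairs ℓ) := by
  rintro ⟨a, b⟩ h ⟨c, d⟩ h' heq
  rw [mem_coe, mem_pairs] at h h'
  have key := Finset.ext_iff.1 heq
  simp only [mem_insert, mem_singleton] at key
  have mem_a := (key a).1 (by simp)
  have mem_b := (key b).1 (by simp)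
  rw [Prod.mk.injEq]
  omega

theorem powersetCard_two_range (ℓ : ℕ) :
    powersetCard 2 (range ℓ) = (pairs ℓ).image fun p => {p.1, p.2} := by
  ext A
  simp only [mem_powersetCard, card_eq_two, mem_image, Prod.exists, mem_pairs]
  constructor
  · rintro ⟨hA, a, b, hab, rfl⟩
    simp only [insert_subset_iff, singleton_subset_iff, mem_range] at hA
    rcases lt_or_gt_of_ne hab with h | h
    · exact ⟨a, b, ⟨h, hA.2⟩, rfl⟩
    · exact ⟨b, a, ⟨h, hA.1⟩, pair_comm b a⟩
  · rintro ⟨a, b, h, rfl⟩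
    simp only [insert_subset_iff, singleton_subset_iff, mem_range]
    exact ⟨by omega, a, b, by omega, rfl⟩

theorem evenPairs_eq_image_pairs (ℓ : ℕ) :
    evenPairs ℓ = {p ∈ pairs ℓ | p.1 % 2 = p.2 % 2}.image fun p => {p.1, p.2} := by
  ext A
  constructor
  · intro hA
    obtain ⟨p, hp, rfl⟩ := mem_image.1
      ((powersetCard_two_range ℓ).subset (evenPairs_subset_powersetCard ℓ hA))
    exact mem_image_of_mem _ (mem_filter.2 ⟨hp, (pair_mem_evenPairs.1 hA).2.2.2⟩)
  · simp only [mem_image, mem_filter, mem_pairs]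
    rintro ⟨p, hp, rfl⟩
    rw [pair_mem_evenPairs]
    omega

/-- Two distinct pairs with a common sum: the outer and the inner two elements of a quadruple. -/
abbrev SumMatched (p q : ℕ × ℕ) : Prop := p.1 + p.2 = q.1 + q.2 ∧ p ≠ q

/-- Two disjoint pairs with a common difference: opposite sides of a parallelogram. -/
abbrev DiffMatched (p q : ℕ × ℕ) : Prop :=
  p.2 - p.1 = q.2 - q.1 ∧ ¬ Near (p.2 - p.1) p.1 q.1

theorem matched_quads_iff {ℓ : ℕ} {p q : ℕ × ℕ} (hp : p ∈ pairs ℓ) (hq : q ∈ pairs ℓ) :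
    Matched (quads ℓ) {p.1, p.2} {q.1, q.2} ↔ SumMatched p q ∨ DiffMatched p q := by
  obtain ⟨a, b⟩ := p
  obtain ⟨c, d⟩ := q
  rw [mem_pairs] at hp hq
  simp only [Matched, SumMatched, DiffMatched, Near, disjoint_insert_left,
    disjoint_singleton_left, mem_insert, mem_singleton, insert_union, singleton_union, ne_eq,
    Prod.mk.injEq] at hp hq ⊢
  constructor
  · rintro ⟨hdisj, hmem⟩
    have hadd := add_eq_add_of_insert_mem_quads (by omega) (by omega) (by omega) (by omega)
      (by omega) (by omega) hmem
    omega
  · rintro (h | h)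
    · exact ⟨by omega, insert_mem_quads_of_add_eq (by omega) (by omega) (by omega) (by omega)
        (by omega) (by omega) (by omega) (by omega) h.1⟩
    · have hperm : ({a, b, c, d} : Finset ℕ) = {a, d, b, c} := by
        ext y
        simp only [mem_insert, mem_singleton]
        tauto
      rw [hperm]
      exact ⟨by omega, insert_mem_quads_of_add_eq (by omega) (by omega) (by omega) (by omega)
        (by omega) (by omega) (by omega) (by omega) (by omega)⟩

/-! ### Sums of truncated arithmetic progressions -/

theorem sum_range_add_tsub_mul {φ : ℕ → ℝ} (hφ : φ 0 = 0) {c : ℕ} (hc : 0 < c) (n : ℕ) :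
    ∑ s ∈ range (n + c), φ (n + c - c * (s + 1)) = φ n + ∑ s ∈ range n, φ (n - c * (s + 1)) := by
  obtain ⟨d, rfl⟩ := Nat.exists_eq_succ_of_ne_zero hc.ne'
  rw [Nat.add_succ, sum_range_succ', add_comm]
  congr 1
  · congr 1
    omega
  · symm
    refine (sum_subset (range_mono (Nat.le_add_right n d)) fun s _ hs => ?_).trans
      (sum_congr rfl fun s _ => ?_)
    · rw [mem_range, not_lt] at hs
      rw [Nat.sub_eq_zero_of_le (by nlinarith), hφ]
    · congr 1
      rw [mul_add _ (s + 1)]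
      omega

theorem sum_range_tsub_mul {c : ℕ} (hc : 0 < c) (n : ℕ) :
    ∑ s ∈ range n, ((n - c * (s + 1) : ℕ) : ℝ)
      = (n * (n - c) + (n % c : ℕ) * (c - (n % c : ℕ))) / (2 * c) := by
  have hc' : (c : ℝ) ≠ 0 := by positivity
  induction n using Nat.strong_induction_on with
  | _ n ih =>
    rcases lt_or_ge n c with hlt | hge
    · rw [Nat.mod_eq_of_lt hlt, sum_eq_zero fun s _ => ?_]
      · ring
      · rw [Nat.sub_eq_zero_of_le (by nlinarith), Nat.cast_zero]
    · obtain ⟨m, rfl⟩ := Nat.exists_eq_add_of_le' hge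
      rw [sum_range_add_tsub_mul (φ := Nat.cast) Nat.cast_zero hc, ih m (by omega),
        Nat.add_mod_right, Nat.cast_add]
      field_simp
      ring

theorem cast_mod_two_sq (n : ℕ) : ((n % 2 : ℕ) : ℝ) ^ 2 = (n % 2 : ℕ) := by
  rcases Nat.mod_two_eq_zero_or_one n with h | h <;> simp [h]

theorem sum_range_tsub_two_mul (n : ℕ) :
    ∑ s ∈ range n, ((n - 2 * (s + 1) : ℕ) : ℝ) = (n * (n - 2) + (n % 2 : ℕ)) / 4 := by
  rw [sum_range_tsub_mul two_pos]
  push_cast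
  linear_combination -(1 / 4 : ℝ) * cast_mod_two_sq n

theorem sum_range_tsub_two_mul_sq (n : ℕ) :
    ∑ s ∈ range n, ((n - 2 * (s + 1) : ℕ) : ℝ) ^ 2 = n * (n - 1) * (n - 2) / 6 := by
  induction n using Nat.twoStepInduction with
  | zero => simp
  | one => simp
  | more n ih _ =>
    rw [sum_range_add_tsub_mul (φ := fun m => (m : ℝ) ^ 2) (by simp) two_pos, ih]
    push_cast
    ring

theorem sum_range_tsub_two_mul_choose (n : ℕ) :
    ∑ s ∈ range n, ((n - 2 * (s + 1) : ℕ) : ℝ) * ((n - 2 * (s + 1) : ℕ) - 1) / 2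
      = (n * (n - 1) * (n - 2) / 6 - (n * (n - 2) + (n % 2 : ℕ)) / 4) / 2 := by
  rw [← sum_range_tsub_two_mul_sq, ← sum_range_tsub_two_mul, ← sum_sub_distrib, sum_div]
  exact sum_congr rfl fun s _ => by ring

/-- The number of three-element subsets of `range n` whose elements have the same parity, in
closed form. -/
noncomputable def parityTriples (n : ℕ) : ℝ :=
  (n ^ 3 - 6 * n ^ 2 + 8 * n + 3 * (n % 2 : ℕ) * (n - 2)) / 24

theorem parityTriples_eq_halves (n : ℕ) :
    (((n + 1) / 2 : ℕ) : ℝ) * (((n + 1) / 2 : ℕ) - 1) * (((n + 1) / 2 : ℕ) - 2)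
      + ((n / 2 : ℕ) : ℝ) * ((n / 2 : ℕ) - 1) * ((n / 2 : ℕ) - 2) = 6 * parityTriples n := by
  unfold parityTriples
  obtain ⟨k, rfl | rfl⟩ := Nat.even_or_odd' n
  · rw [show (2 * k + 1) / 2 = k by omega, show 2 * k / 2 = k by omega, Nat.mul_mod_right]
    push_cast
    ring
  · rw [show (2 * k + 1 + 1) / 2 = k + 1 by omega, show (2 * k + 1) / 2 = k by omega,
      show (2 * k + 1) % 2 = 1 by omega]
    push_cast
    ring

theorem sum_range_div_two_mul (n : ℕ) :
    ∑ i ∈ range n, ((i / 2 : ℕ) : ℝ) * ((i / 2 : ℕ) - 1) = 2 * parityTriples n := by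
  unfold parityTriples
  induction n using Nat.twoStepInduction with
  | zero => simp
  | one => norm_num
  | more n ih _ =>
    rw [sum_range_succ, sum_range_succ, ih, Nat.add_mod_right]
    obtain ⟨k, rfl | rfl⟩ := Nat.even_or_odd' n
    · rw [show (2 * k + 1) / 2 = k by omega, show 2 * k / 2 = k by omega, Nat.mul_mod_right]
      push_cast
      ring
    · rw [show (2 * k + 1 + 1) / 2 = k + 1 by omega, show (2 * k + 1) / 2 = k by omega,
        show (2 * k + 1) % 2 = 1 by omega]
      push_cast
      ring

theorem sum_range_tsub_two_mul_quasi (n : ℕ) :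
    ∑ s ∈ range n, (((n - 2 * (s + 1) : ℕ) : ℝ) * ((n - 2 * (s + 1) : ℕ) - 2)
      + ((n - 2 * (s + 1)) % 2 : ℕ)) / 4 = parityTriples n := by
  unfold parityTriples
  induction n using Nat.twoStepInduction with
  | zero => simp
  | one => norm_num
  | more n ih _ =>
    rw [sum_range_add_tsub_mul (φ := fun m => ((m : ℝ) * (m - 2) + (m % 2 : ℕ)) / 4) (by simp)
      two_pos, ih, Nat.add_mod_right]
    push_cast
    ring

theorem sum_range_parityTriples (n : ℕ) :
    ∑ i ∈ range n, 6 * parityTriples i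
      = (n ^ 4 - 10 * n ^ 3 + 32 * n ^ 2 - 32 * n - (n % 2 : ℕ) * (6 * n - 15)) / 16 := by
  unfold parityTriples
  induction n with
  | zero => simp
  | succ n ih =>
    rw [sum_range_succ, ih]
    obtain ⟨k, rfl | rfl⟩ := Nat.even_or_odd' n
    · rw [show (2 * k + 1) % 2 = 1 by omega, Nat.mul_mod_right]
      push_cast
      ring
    · rw [show (2 * k + 1 + 1) % 2 = 0 by omega, show (2 * k + 1) % 2 = 1 by omega]
      push_cast
      ring

theorem sum_range_tsub_descFactorial (n : ℕ) :
    ∑ s ∈ range n, ((n - (s + 1) : ℕ) : ℝ) * ((n - (s + 1) : ℕ) - 1) * ((n - (s + 1) : ℕ) - 2)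
      = n * (n - 1) * (n - 2) * (n - 3) / 4 := by
  have hreflect := sum_range_reflect (fun m : ℕ => (m : ℝ) * (m - 1) * (m - 2)) n
  simp only [Nat.sub_sub, add_comm 1] at hreflect
  rw [hreflect]
  clear hreflect
  induction n with
  | zero => simp
  | succ n ih =>
    rw [sum_range_succ, ih]
    push_cast
    ring

/-! ### Triangles of matched pairs -/

theorem card_pairs (n : ℕ) : (#(pairs n) : ℝ) = n * (n - 1) / 2 := by
  rw [← Nat.cast_choose_two, ← card_range n, ← card_powersetCard, card_range,
    powersetCard_two_range, card_image_of_injOn (pair_injOn n)]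

theorem card_gapTriples_filter_eq (ℓ : ℕ) :
    #{t ∈ gapTriples ℓ | t.2.1 = t.2.2} = ∑ s ∈ range ℓ, (ℓ - 2 * (s + 1)) := by
  rw [sum_congr rfl fun s _ => (card_range (ℓ - 2 * (s + 1))).symm, ← card_sigma]
  refine card_bij' (fun t _ => ⟨t.2.1 - 1, t.1⟩) (fun p _ => (p.2, p.1 + 1, p.1 + 1)) ?_ ?_ ?_ ?_
  · rintro ⟨x, u, v⟩ h
    simp only [mem_filter, mem_gapTriples, mem_sigma, mem_range] at h ⊢
    omega
  · rintro ⟨s, x⟩ h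
    simp only [mem_filter, mem_gapTriples, mem_sigma, mem_range, and_true] at h ⊢
    omega
  · rintro ⟨x, u, v⟩ h
    simp only [mem_filter, mem_gapTriples] at h
    simp only [Prod.mk.injEq, true_and]
    omega
  · exact fun _ _ => rfl

theorem card_gapTriples_filter_lt (ℓ : ℕ) :
    #{t ∈ gapTriples ℓ | t.2.1 < t.2.2} = ∑ s ∈ range ℓ, #(pairs (ℓ - 2 * (s + 1))) := by
  rw [← card_sigma]
  refine card_bij' (fun t _ => ⟨t.2.1 - 1, t.1, t.1 + t.2.2 - t.2.1⟩)
    (fun p _ => (p.2.1, p.1 + 1, p.1 + 1 + p.2.2 - p.2.1)) ?_ ?_ ?_ ?_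
  · rintro ⟨x, u, v⟩ h
    simp only [mem_filter, mem_gapTriples, mem_sigma, mem_range, mem_pairs] at h ⊢
    omega
  · rintro ⟨s, x, y⟩ h
    simp only [mem_filter, mem_gapTriples, mem_sigma, mem_range, mem_pairs] at h ⊢
    omega
  · rintro ⟨x, u, v⟩ h
    simp only [mem_filter, mem_gapTriples] at h
    simp only [Prod.mk.injEq, true_and]
    omega
  · rintro ⟨s, x, y⟩ h
    simp only [mem_sigma, mem_range, mem_pairs] at h
    simp only [add_tsub_cancel_right, Sigma.mk.injEq, heq_eq_eq, Prod.mk.injEq, true_and]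
    omega

theorem card_evenPairs (ℓ : ℕ) : (#(evenPairs ℓ) : ℝ) = (ℓ * (ℓ - 2) + (ℓ % 2 : ℕ)) / 4 := by
  rw [evenPairs, card_image_of_injOn (by simpa using evenPair_injOn ℓ),
    card_gapTriples_filter_eq, Nat.cast_sum, sum_range_tsub_two_mul]

theorem card_quads_eq_card_gapTriples (ℓ : ℕ) :
    #(quads ℓ) = #{t ∈ gapTriples ℓ | t.2.1 < t.2.2} :=
  card_image_of_injOn (by simpa using quad_injOn ℓ)

theorem card_quads (ℓ : ℕ) :
    (#(quads ℓ) : ℝ) = (ℓ * (ℓ - 1) * (ℓ - 2) / 6 - (ℓ * (ℓ - 2) + (ℓ % 2 : ℕ)) / 4) / 2 := by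
  rw [card_quads_eq_card_gapTriples, card_gapTriples_filter_lt, Nat.cast_sum,
    ← sum_range_tsub_two_mul_choose]
  exact sum_congr rfl fun s _ => card_pairs _

theorem card_range_filter_mod_two {k : ℕ} (hk : k < 2) (n : ℕ) :
    #{a ∈ range n | a % 2 = k} = (n + 1 - k) / 2 := by
  induction n with
  | zero => simp only [range_zero, filter_empty, card_empty]; omega
  | succ n ih =>
    rw [range_add_one, filter_insert]
    split_ifs with h
    · rw [card_insert_of_notMem (by simp), ih]
      omega
    · rw [ih]
      omega

theorem card_symmDiffPairs_evenPairs (ℓ : ℕ) :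
    (#(symmDiffPairs (evenPairs ℓ) (evenPairs ℓ) (evenPairs ℓ)) : ℝ) = 6 * parityTriples ℓ := by
  have hmatched : ∀ a ∈ range ℓ, ∀ b ∈ range ℓ,
      (Matched (evenPairs ℓ) {a} {b} ↔ a % 2 = b % 2 ∧ a ≠ b) := by
    intro a ha b hb
    rw [mem_range] at ha hb
    rw [Matched, disjoint_singleton, singleton_union, pair_mem_evenPairs]
    tauto
  have hmaps : Set.MapsTo (fun a => a % 2) (range ℓ : Finset ℕ) (range 2 : Finset ℕ) :=
    fun a _ => mem_coe.2 (mem_range.2 (Nat.mod_lt a two_pos))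
  rw [card_symmDiffPairs_self (x := 1) (evenPairs_subset_powersetCard ℓ), powersetCard_one,
    map_eq_image, Function.Embedding.coeFn_mk,
    card_triangles_image _ singleton_injective.injOn, triangles_congr hmatched,
    card_triangles_fiberwise (fun a b => a ≠ b) hmaps,
    sum_range_succ, sum_range_one, Nat.cast_add, card_triangles_ne, card_triangles_ne,
    card_range_filter_mod_two two_pos, card_range_filter_mod_two one_lt_two,
    ← parityTriples_eq_halves]
  rfl

theorem card_pairs_filter_add (ℓ τ : ℕ) :
    #{p ∈ pairs ℓ | p.1 + p.2 = τ} = (τ + 1) / 2 - (τ + 1 - ℓ) := by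
  rw [← Nat.card_Ico]
  refine card_bij' (fun p _ => p.1) (fun a _ => (a, τ - a)) ?_ ?_ ?_ fun _ _ => rfl
  · rintro ⟨a, b⟩ h
    simp only [mem_filter, mem_pairs, mem_Ico] at h ⊢
    omega
  · intro a h
    simp only [mem_filter, mem_pairs, mem_Ico] at h ⊢
    omega
  · rintro ⟨a, b⟩ h
    simp only [mem_filter, mem_pairs] at h
    simp only [Prod.mk.injEq, true_and]
    omega

theorem mapsTo_add_pairs (ℓ : ℕ) :
    Set.MapsTo (fun p : ℕ × ℕ => p.1 + p.2) (pairs ℓ) (range (2 * ℓ) : Finset ℕ) := by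
  rintro ⟨a, b⟩ hp
  simp only [mem_coe, mem_pairs, mem_range] at hp ⊢
  omega

theorem sum_range_card_pairs_filter_add {M : Type*} [AddCommMonoid M] (φ : ℕ → ℕ → M) (ℓ : ℕ) :
    ∑ τ ∈ range (2 * ℓ), φ τ #{p ∈ pairs ℓ | p.1 + p.2 = τ}
      = ∑ i ∈ range ℓ, (φ i ((i + 1) / 2) + φ (2 * ℓ - 1 - i) (i / 2)) := by
  simp only [card_pairs_filter_add]
  rw [two_mul ℓ, sum_range_add, sum_add_distrib]
  congr 1
  · refine sum_congr rfl fun i hi => ?_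
    rw [mem_range] at hi
    congr 1
    omega
  · rw [← sum_range_reflect]
    refine sum_congr rfl fun i hi => ?_
    rw [mem_range] at hi
    congr 1 <;> omega

theorem card_triangles_sumMatched (ℓ : ℕ) :
    (#(triangles SumMatched (pairs ℓ)) : ℝ)
      = (ℓ ^ 4 - 10 * ℓ ^ 3 + 32 * ℓ ^ 2 - 32 * ℓ - (ℓ % 2 : ℕ) * (6 * ℓ - 15)) / 16 := by
  rw [card_triangles_fiberwise (fun p q => p ≠ q) (mapsTo_add_pairs ℓ), Nat.cast_sum]
  simp only [card_triangles_ne]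
  rw [sum_range_card_pairs_filter_add fun _ h => (h : ℝ) * (h - 1) * (h - 2),
    ← sum_range_parityTriples]
  exact sum_congr rfl fun i _ => parityTriples_eq_halves i

theorem mapsTo_sub_pairs (ℓ : ℕ) :
    Set.MapsTo (fun p : ℕ × ℕ => p.2 - p.1) (pairs ℓ) ((range ℓ).image (· + 1) : Finset ℕ) := by
  rintro ⟨a, b⟩ hp
  simp only [mem_coe, mem_pairs, mem_image, mem_range] at hp ⊢
  exact ⟨b - a - 1, by omega, by omega⟩

theorem pairs_filter_sub {δ : ℕ} (hδ : 0 < δ) (ℓ : ℕ) :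
    {p ∈ pairs ℓ | p.2 - p.1 = δ} = (range (ℓ - δ)).image fun a => (a, a + δ) := by
  ext ⟨a, b⟩
  simp only [mem_filter, mem_pairs, mem_image, mem_range, Prod.mk.injEq]
  constructor
  · rintro ⟨h, hsub⟩
    exact ⟨a, by omega, rfl, by omega⟩
  · rintro ⟨a, h, rfl, rfl⟩
    omega

theorem card_triangles_diffMatched (ℓ : ℕ) :
    (#(triangles DiffMatched (pairs ℓ)) : ℝ)
      = ∑ s ∈ range ℓ, (((ℓ - (s + 1) : ℕ) : ℝ) * ((ℓ - (s + 1) : ℕ) - 1)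
          * ((ℓ - (s + 1) : ℕ) - 2)
        - 6 * (ℓ - 2 * (s + 1) : ℕ) * ((ℓ - (s + 1) : ℕ) - 2) + 6 * (ℓ - 3 * (s + 1) : ℕ)) := by
  rw [card_triangles_fiberwise (fun p q => ¬ Near (p.2 - p.1) p.1 q.1) (mapsTo_sub_pairs ℓ),
    sum_image (add_left_injective 1).injOn, Nat.cast_sum]
  refine sum_congr rfl fun s _ => ?_
  rw [pairs_filter_sub s.succ_pos, card_triangles_image _ fun a _ b _ h => (Prod.mk.inj h).1]
  simp only [add_tsub_cancel_left]
  rw [card_triangles_far s.succ_pos,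
    show ℓ - (s + 1) - (s + 1) = ℓ - 2 * (s + 1) by omega,
    show ℓ - (s + 1) - 2 * (s + 1) = ℓ - 3 * (s + 1) by omega]

theorem card_symmDiffPairs_quads_eq_add (ℓ : ℕ) :
    #(symmDiffPairs (quads ℓ) (quads ℓ) (quads ℓ))
      = #(triangles SumMatched (pairs ℓ)) + #(triangles DiffMatched (pairs ℓ)) := by
  rw [card_symmDiffPairs_self (x := 2) (quads_subset_powersetCard ℓ), powersetCard_two_range,
    card_triangles_image _ (pair_injOn ℓ),
    triangles_congr fun p hp q hq => matched_quads_iff hp hq]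
  apply card_triangles_or
  · rintro ⟨a, b⟩ hp ⟨c, d⟩ hq
    simp only [mem_pairs] at hp hq ⊢
    omega
  · rintro ⟨a, b⟩ hp ⟨c, d⟩ hq ⟨e, f⟩ hr
    simp only [mem_pairs, Prod.mk.injEq, Near, ne_eq, SumMatched, DiffMatched] at hp hq hr ⊢
    omega

/-! ### Two pairs of equal parity and a parallelogram -/

/-- The increasing pairs of elements of `range ℓ` with the same parity. -/
def parityPairs (ℓ : ℕ) : Finset (ℕ × ℕ) := {p ∈ pairs ℓ | p.1 % 2 = p.2 % 2}

theorem parityPairs_subset_pairs (ℓ : ℕ) : parityPairs ℓ ⊆ pairs ℓ := filter_subset _ _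

theorem card_symmDiffPairs_evenPairs_quads_eq_add (ℓ : ℕ) :
    #(symmDiffPairs (evenPairs ℓ) (evenPairs ℓ) (quads ℓ))
      = #{p ∈ parityPairs ℓ ×ˢ parityPairs ℓ | SumMatched p.1 p.2}
        + #{p ∈ parityPairs ℓ ×ˢ parityPairs ℓ | DiffMatched p.1 p.2} := by
  have hsub := parityPairs_subset_pairs ℓ
  have hmatched : symmDiffPairs (evenPairs ℓ) (evenPairs ℓ) (quads ℓ)
      = {p ∈ evenPairs ℓ ×ˢ evenPairs ℓ | Matched (quads ℓ) p.1 p.2} := by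
    refine filter_congr fun p hp => ?_
    rw [mem_product] at hp
    exact symmDiff_mem_iff_matched (fun C hC => (mem_powersetCard.1
      (quads_subset_powersetCard ℓ hC)).2)
      (mem_powersetCard.1 (evenPairs_subset_powersetCard ℓ hp.1)).2
      (mem_powersetCard.1 (evenPairs_subset_powersetCard ℓ hp.2)).2
  rw [hmatched, evenPairs_eq_image_pairs, ← parityPairs,
    card_filter_related_image (Matched (quads ℓ)) ((pair_injOn ℓ).mono (coe_subset.2 hsub)),
    filter_congr fun p hp => matched_quads_iff (hsub (mem_product.1 hp).1)
      (hsub (mem_product.1 hp).2), filter_or, card_union_of_disjoint]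
  rw [disjoint_filter]
  rintro ⟨⟨a, b⟩, c, d⟩ hp
  simp only [mem_product, parityPairs, mem_filter, mem_pairs] at hp ⊢
  omega

theorem card_parityPairs_filter_add (ℓ τ : ℕ) :
    #{p ∈ parityPairs ℓ | p.1 + p.2 = τ}
      = if τ % 2 = 0 then #{p ∈ pairs ℓ | p.1 + p.2 = τ} else 0 := by
  rw [parityPairs, filter_filter]
  split_ifs with h
  · refine congrArg card (filter_congr fun p _ => ?_)
    omega
  · rw [card_eq_zero, filter_eq_empty_iff]
    omega

theorem card_parityPairs_sumMatched (ℓ : ℕ) :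
    (#{p ∈ parityPairs ℓ ×ˢ parityPairs ℓ | SumMatched p.1 p.2} : ℝ) = 2 * parityTriples ℓ := by
  rw [card_filter_related_fiberwise (fun p q => p ≠ q) ((mapsTo_add_pairs ℓ).mono_left
    (coe_subset.2 (parityPairs_subset_pairs ℓ))), Nat.cast_sum]
  simp only [card_filter_ne, card_parityPairs_filter_add]
  rw [sum_range_card_pairs_filter_add fun τ h =>
    (((if τ % 2 = 0 then h else 0 : ℕ) : ℝ) * ((if τ % 2 = 0 then h else 0 : ℕ) - 1)),
    ← sum_range_div_two_mul]
  refine sum_congr rfl fun i hi => ?_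
  rw [mem_range] at hi
  rcases Nat.mod_two_eq_zero_or_one i with h | h
  · rw [if_pos h, if_neg (by omega), show (i + 1) / 2 = i / 2 by omega]
    simp
  · rw [if_neg (by omega), if_pos (by omega)]
    simp

theorem mapsTo_sub_parityPairs (ℓ : ℕ) : Set.MapsTo (fun p : ℕ × ℕ => p.2 - p.1) (parityPairs ℓ)
    ((range ℓ).image fun s => 2 * (s + 1) : Finset ℕ) := by
  rintro ⟨a, b⟩ hp
  simp only [mem_coe, parityPairs, mem_filter, mem_pairs, mem_image, mem_range] at hp ⊢
  exact ⟨(b - a) / 2 - 1, by omega, by omega⟩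

theorem parityPairs_filter_sub (ℓ s : ℕ) :
    {p ∈ parityPairs ℓ | p.2 - p.1 = 2 * s} = {p ∈ pairs ℓ | p.2 - p.1 = 2 * s} := by
  rw [parityPairs, filter_filter]
  refine filter_congr fun p hp => ?_
  rw [mem_pairs] at hp
  omega

theorem card_parityPairs_diffMatched (ℓ : ℕ) :
    (#{p ∈ parityPairs ℓ ×ˢ parityPairs ℓ | DiffMatched p.1 p.2} : ℝ)
      = ∑ s ∈ range ℓ, (((ℓ - 2 * (s + 1) : ℕ) : ℝ) * ((ℓ - 2 * (s + 1) : ℕ) - 1)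
        - 2 * (ℓ - 4 * (s + 1) : ℕ)) := by
  have hinj : Function.Injective fun s => 2 * (s + 1) := fun a b h => by
    dsimp only at h
    omega
  rw [card_filter_related_fiberwise (fun p q => ¬ Near (p.2 - p.1) p.1 q.1)
    (mapsTo_sub_parityPairs ℓ), sum_image hinj.injOn, Nat.cast_sum]
  refine sum_congr rfl fun s _ => ?_
  rw [parityPairs_filter_sub, pairs_filter_sub (by omega),
    card_filter_related_image (fun p q => ¬ Near (p.2 - p.1) p.1 q.1)
      fun a _ b _ h => (Prod.mk.inj h).1]
  simp only [add_tsub_cancel_left]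
  rw [card_pairs_far (by omega),
    show ℓ - 2 * (s + 1) - 2 * (s + 1) = ℓ - 4 * (s + 1) by omega]

/-! ### Two parallelograms with three common points -/

theorem sum_mod_two_of_mem_quads {ℓ : ℕ} {q : Finset ℕ} (hq : q ∈ quads ℓ) :
    (∑ a ∈ q, a) % 2 = 0 := by
  obtain ⟨x, u, v, hu, huv, -, rfl⟩ := mem_quads.1 hq
  rw [sum_insert, sum_insert, sum_pair]
  · omega
  all_goals simp only [mem_insert, mem_singleton, ne_eq]; omega

/-- The points that complete `X` to a member of `quads ℓ`. -/
def completions (ℓ : ℕ) (X : Finset ℕ) : Finset ℕ := {w ∈ range ℓ | Matched (quads ℓ) X {w}}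

theorem sum_add_mod_two_of_mem_completions {ℓ w : ℕ} {X : Finset ℕ} (hw : w ∈ completions ℓ X) :
    (∑ a ∈ X, a + w) % 2 = 0 := by
  obtain ⟨hdisj, hmem⟩ := (mem_filter.1 hw).2
  rw [← sum_singleton (fun a => a) w, ← sum_union hdisj]
  exact sum_mod_two_of_mem_quads hmem

theorem matched_evenPairs_of_mem_completions {ℓ v w : ℕ} {X : Finset ℕ}
    (hv : v ∈ completions ℓ X) (hw : w ∈ completions ℓ X) :
    Matched (evenPairs ℓ) {v} {w} ↔ v ≠ w := by
  have hv' := sum_add_mod_two_of_mem_completions hv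
  have hw' := sum_add_mod_two_of_mem_completions hw
  have hv_lt := mem_range.1 (mem_filter.1 hv).1
  have hw_lt := mem_range.1 (mem_filter.1 hw).1
  rw [Matched, disjoint_singleton, singleton_union, pair_mem_evenPairs]
  refine ⟨fun h => h.1, fun h => ⟨h, hv_lt, hw_lt, h, ?_⟩⟩
  omega

theorem card_symmDiffPairs_quads_evenPairs (ℓ : ℕ) :
    (#(symmDiffPairs (quads ℓ) (quads ℓ) (evenPairs ℓ)) : ℝ)
      = ∑ X ∈ powersetCard 3 (range ℓ), (#(completions ℓ X) : ℝ) * (#(completions ℓ X) - 1) := by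
  rw [card_symmDiffPairs (x := 3) (y := 1) (z := 1) (quads_subset_powersetCard ℓ)
    (quads_subset_powersetCard ℓ) (evenPairs_subset_powersetCard ℓ),
    card_filter, sum_product, Nat.cast_sum]
  refine sum_congr rfl fun X _ => ?_
  rw [← card_filter_ne, ← card_filter, Nat.cast_inj]
  symm
  refine card_nbij (fun p => ({p.1}, {p.2})) ?_ ?_ ?_
  · rintro ⟨v, w⟩ h
    simp only [coe_filter, mem_product, Set.mem_ofPred_eq, mem_powersetCard,
      singleton_subset_iff, card_singleton, and_true] at h ⊢
    exact ⟨⟨(mem_filter.1 h.1.1).1, (mem_filter.1 h.1.2).1⟩, (mem_filter.1 h.1.1).2,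
      (mem_filter.1 h.1.2).2, (matched_evenPairs_of_mem_completions h.1.1 h.1.2).2 h.2⟩
  · rintro ⟨v, w⟩ - ⟨v', w'⟩ - h
    simpa only [Prod.mk.injEq, singleton_inj] using h
  · rintro ⟨Y, Z⟩ h
    simp only [coe_filter, mem_product, Set.mem_ofPred_eq, mem_powersetCard, card_eq_one] at h
    obtain ⟨⟨⟨hY, v, rfl⟩, hZ, w, rfl⟩, hXY, hXZ, hYZ⟩ := h
    rw [singleton_subset_iff] at hY hZ
    have hv : v ∈ completions ℓ X := mem_filter.2 ⟨hY, hXY⟩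
    have hw : w ∈ completions ℓ X := mem_filter.2 ⟨hZ, hXZ⟩
    exact ⟨(v, w), by
      simpa only [coe_filter, mem_product, Set.mem_ofPred_eq] using
        ⟨⟨hv, hw⟩, (matched_evenPairs_of_mem_completions hv hw).1 hYZ⟩, rfl⟩

theorem gapSet_injOn (ℓ : ℕ) : Set.InjOn
    (fun t : ℕ × ℕ × ℕ => ({t.1, t.1 + t.2.1, t.1 + t.2.1 + t.2.2} : Finset ℕ))
      (gapTriples ℓ) := by
  rintro ⟨x, u, v⟩ h ⟨x', u', v'⟩ h' heq
  simp only [mem_coe, mem_gapTriples] at h h'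
  have key := Finset.ext_iff.1 heq
  simp only [mem_insert, mem_singleton] at key
  have mem_x := (key x).1 (by simp)
  have mem_x' := (key x').2 (by simp)
  have mem_xu := (key (x + u)).1 (by simp)
  have mem_xu' := (key (x' + u')).2 (by simp)
  have mem_xuv := (key (x + u + v)).1 (by simp)
  simp only [Prod.mk.injEq]
  omega

theorem exists_lt_lt_of_card_eq_three {α : Type*} [LinearOrder α] {X : Finset α} (hX : #X = 3) :
    ∃ a b c, a < b ∧ b < c ∧ X = {a, b, c} := by
  have hmono := (X.orderEmbOfFin hX).strictMono
  refine ⟨X.orderEmbOfFin hX 0, X.orderEmbOfFin hX 1, X.orderEmbOfFin hX 2, hmono (by decide),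
    hmono (by decide), ?_⟩
  refine (image_orderEmbOfFin_univ X hX).symm.trans ?_
  rw [show (univ : Finset (Fin 3)) = {0, 1, 2} from rfl, image_insert, image_insert,
    image_singleton]

theorem powersetCard_three_range (ℓ : ℕ) : powersetCard 3 (range ℓ)
    = (gapTriples ℓ).image fun t => {t.1, t.1 + t.2.1, t.1 + t.2.1 + t.2.2} := by
  ext X
  simp only [mem_powersetCard, mem_image, Prod.exists, mem_gapTriples]
  constructor
  · rintro ⟨hX, hcard⟩
    obtain ⟨a, b, c, hab, hbc, rfl⟩ := exists_lt_lt_of_card_eq_three hcard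
    simp only [insert_subset_iff, singleton_subset_iff, mem_range] at hX
    exact ⟨a, b - a, c - b, by omega, by
      rw [Nat.add_sub_of_le hab.le, Nat.add_sub_of_le hbc.le]⟩
  · rintro ⟨x, u, v, h, rfl⟩
    simp only [insert_subset_iff, singleton_subset_iff, mem_range]
    exact ⟨by omega, card_eq_three.2
      ⟨x, x + u, x + u + v, by omega, by omega, by omega, rfl⟩⟩

theorem mem_completions_gapSet {ℓ x u v w : ℕ} (h : (x, u, v) ∈ gapTriples ℓ) :
    w ∈ completions ℓ {x, x + u, x + u + v}
      ↔ w < ℓ ∧ (w + v = x ∨ w = x + 2 * u + v ∨ w = x + v ∧ u ≠ v) := by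
  rw [mem_gapTriples] at h
  simp only [completions, mem_filter, mem_range, Matched, disjoint_singleton_right, mem_insert,
    mem_singleton, not_or]
  refine and_congr_right fun hw => ⟨?_, ?_⟩
  · rintro ⟨hne, hmem⟩
    rw [insert_union, insert_union, singleton_union] at hmem
    have hadd := add_eq_add_of_insert_mem_quads (by omega) (by omega) (by omega) (by omega)
      (by omega) (by omega) hmem
    omega
  · intro hcase
    have hne : w ≠ x ∧ w ≠ x + u ∧ w ≠ x + u + v := by omega
    refine ⟨hne, ?_⟩
    rw [insert_union, insert_union, singleton_union]
    rcases hcase with hcase | hcase | hcase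
    · have hperm : ({x, x + u, x + u + v, w} : Finset ℕ) = {x, x + u, w, x + u + v} := by
        rw [pair_comm (x + u + v)]
      rw [hperm]
      apply insert_mem_quads_of_add_eq <;> omega
    · have hperm : ({x, x + u, x + u + v, w} : Finset ℕ) = {x, w, x + u, x + u + v} := by
        rw [pair_comm (x + u + v), insert_comm (x + u)]
      rw [hperm]
      apply insert_mem_quads_of_add_eq <;> omega
    · have hperm : ({x, x + u, x + u + v, w} : Finset ℕ) = {x, x + u + v, x + u, w} := by
        rw [insert_comm (x + u)]
      rw [hperm]
      apply insert_mem_quads_of_add_eq <;> omega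

theorem card_completions_gapSet {ℓ x u v : ℕ} (h : (x, u, v) ∈ gapTriples ℓ) :
    #(completions ℓ {x, x + u, x + u + v})
      = (if v ≤ x then 1 else 0) + (if x + 2 * u + v < ℓ then 1 else 0)
        + (if u ≠ v then 1 else 0) := by
  have hsplit : ∀ w ∈ range ℓ, (if w ∈ completions ℓ {x, x + u, x + u + v} then 1 else 0)
      = (if w = x - v then if v ≤ x then 1 else 0 else 0)
        + (if w = x + 2 * u + v then 1 else 0)
        + (if w = x + v then if u ≠ v then 1 else 0 else 0) := by
    intro w hw
    rw [mem_range] at hw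
    simp only [mem_completions_gapSet h]
    rw [mem_gapTriples] at h
    grind
  have hself : completions ℓ {x, x + u, x + u + v}
      = {w ∈ range ℓ | w ∈ completions ℓ {x, x + u, x + u + v}} := by
    ext w
    rw [mem_filter]
    exact (and_iff_right_of_imp fun hw => (mem_filter.1 hw).1).symm
  rw [mem_gapTriples] at h
  rw [hself, card_filter, sum_congr rfl hsplit, sum_add_distrib, sum_add_distrib, sum_ite_eq',
    sum_ite_eq', sum_ite_eq', if_pos (mem_range.2 (by omega : x - v < ℓ)),
    if_pos (mem_range.2 (by omega : x + v < ℓ))]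
  simp only [mem_range]

theorem card_gapTriples_filter_le_left (ℓ : ℕ) :
    #{t ∈ gapTriples ℓ | t.2.2 ≤ t.1} = #{t ∈ gapTriples ℓ | t.2.1 < t.2.2} := by
  refine card_bij' (fun t _ => (t.1 - t.2.2, t.2.2, t.2.1 + t.2.2))
    (fun t _ => (t.1 + t.2.1, t.2.2 - t.2.1, t.2.1)) ?_ ?_ ?_ ?_
  all_goals
    rintro ⟨x, u, v⟩ h
    simp only [mem_filter, mem_gapTriples, Prod.mk.injEq, true_and, and_true] at h ⊢
    omega

theorem card_gapTriples_filter_lt_right (ℓ : ℕ) :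
    #{t ∈ gapTriples ℓ | t.1 + 2 * t.2.1 + t.2.2 < ℓ} = #{t ∈ gapTriples ℓ | t.2.1 < t.2.2} := by
  refine card_bij' (fun t _ => (t.1, t.2.1, t.2.1 + t.2.2))
    (fun t _ => (t.1, t.2.1, t.2.2 - t.2.1)) ?_ ?_ ?_ ?_
  all_goals
    rintro ⟨x, u, v⟩ h
    simp only [mem_filter, mem_gapTriples, Prod.mk.injEq, true_and] at h ⊢
    omega

theorem card_gapTriples_filter_lt_right_eq (ℓ : ℕ) :
    #{t ∈ gapTriples ℓ | t.1 + 2 * t.2.1 + t.2.2 < ℓ ∧ t.2.1 = t.2.2}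
      = ∑ s ∈ range ℓ, (ℓ - 3 * (s + 1)) := by
  rw [sum_congr rfl fun s _ => (card_range (ℓ - 3 * (s + 1))).symm, ← card_sigma]
  refine card_bij' (fun t _ => ⟨t.2.1 - 1, t.1⟩) (fun p _ => (p.2, p.1 + 1, p.1 + 1)) ?_ ?_ ?_
    fun _ _ => rfl
  · rintro ⟨x, u, v⟩ h
    simp only [mem_filter, mem_gapTriples, mem_sigma, mem_range] at h ⊢
    omega
  · rintro ⟨s, x⟩ h
    simp only [mem_filter, mem_gapTriples, mem_sigma, mem_range, and_true] at h ⊢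
    omega
  · rintro ⟨x, u, v⟩ h
    simp only [mem_filter, mem_gapTriples] at h
    simp only [Prod.mk.injEq, true_and]
    omega

theorem card_gapTriples_filter_le_left_eq (ℓ : ℕ) :
    #{t ∈ gapTriples ℓ | t.2.2 ≤ t.1 ∧ t.2.1 = t.2.2} = ∑ s ∈ range ℓ, (ℓ - 3 * (s + 1)) := by
  rw [← card_gapTriples_filter_lt_right_eq]
  refine card_bij' (fun t _ => (t.1 - t.2.1, t.2.1, t.2.2))
    (fun t _ => (t.1 + t.2.1, t.2.1, t.2.2)) ?_ ?_ ?_ ?_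
  all_goals
    rintro ⟨x, u, v⟩ h
    simp only [mem_filter, mem_gapTriples, Prod.mk.injEq, and_true] at h ⊢
    omega

theorem card_gapTriples_filter_le_left_lt_right (ℓ : ℕ) :
    #{t ∈ gapTriples ℓ | t.2.2 ≤ t.1 ∧ t.1 + 2 * t.2.1 + t.2.2 < ℓ}
      = ∑ s ∈ range ℓ, #{t ∈ gapTriples (ℓ - 2 * (s + 1)) | t.2.1 = t.2.2} := by
  rw [← card_sigma]
  refine card_bij' (fun t _ => ⟨t.2.2 - 1, t.1 - t.2.2, t.2.1, t.2.1⟩)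
    (fun p _ => (p.2.1 + (p.1 + 1), p.2.2.1, p.1 + 1)) ?_ ?_ ?_ ?_
  · rintro ⟨x, u, v⟩ h
    simp only [mem_filter, mem_gapTriples, mem_sigma, mem_range, and_true] at h ⊢
    omega
  · rintro ⟨s, x, u, v⟩ h
    simp only [mem_filter, mem_gapTriples, mem_sigma, mem_range] at h ⊢
    omega
  · rintro ⟨x, u, v⟩ h
    simp only [mem_filter, mem_gapTriples] at h
    simp only [Prod.mk.injEq, true_and]
    omega
  · rintro ⟨s, x, u, v⟩ h
    simp only [mem_filter, mem_gapTriples, mem_sigma, mem_range] at h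
    simp only [add_tsub_cancel_right, Sigma.mk.injEq, heq_eq_eq, Prod.mk.injEq, true_and]
    omega

theorem ite_add_ite_add_ite_mul_sub_one (p q r : Prop) [Decidable p] [Decidable q] [Decidable r] :
    (((if p then 1 else 0) + (if q then 1 else 0) + (if r then 1 else 0) : ℕ) : ℝ)
        * (((if p then 1 else 0) + (if q then 1 else 0) + (if r then 1 else 0) : ℕ) - 1)
      = 2 * (((if p ∧ q then 1 else 0 : ℕ) : ℝ) + (if p ∧ r then 1 else 0 : ℕ)
        + (if q ∧ r then 1 else 0 : ℕ)) := by
  by_cases hp : p <;> by_cases hq : q <;> by_cases hr : r <;> norm_num [hp, hq, hr]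

theorem sum_card_completions (ℓ : ℕ) :
    ∑ X ∈ powersetCard 3 (range ℓ), (#(completions ℓ X) : ℝ) * (#(completions ℓ X) - 1)
      = 2 * (#{t ∈ gapTriples ℓ | t.2.2 ≤ t.1 ∧ t.1 + 2 * t.2.1 + t.2.2 < ℓ}
        + #{t ∈ gapTriples ℓ | t.2.2 ≤ t.1 ∧ t.2.1 ≠ t.2.2}
        + #{t ∈ gapTriples ℓ | t.1 + 2 * t.2.1 + t.2.2 < ℓ ∧ t.2.1 ≠ t.2.2}) := by
  rw [powersetCard_three_range, sum_image (gapSet_injOn ℓ)]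
  simp only [card_filter, Nat.cast_sum]
  rw [← sum_add_distrib, ← sum_add_distrib, mul_sum]
  refine sum_congr rfl ?_
  rintro ⟨x, u, v⟩ h
  rw [card_completions_gapSet h]
  exact ite_add_ite_add_ite_mul_sub_one _ _ _

theorem sum_card_gapTriples_filter_eq (ℓ : ℕ) :
    ∑ s ∈ range ℓ, (#{t ∈ gapTriples (ℓ - 2 * (s + 1)) | t.2.1 = t.2.2} : ℝ)
      = parityTriples ℓ := by
  rw [← sum_range_tsub_two_mul_quasi]
  refine sum_congr rfl fun s _ => ?_
  rw [card_gapTriples_filter_eq, Nat.cast_sum, sum_range_tsub_two_mul]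

theorem card_symmDiffPairs_quads_evenPairs_eq (ℓ : ℕ) :
    (#(symmDiffPairs (quads ℓ) (quads ℓ) (evenPairs ℓ)) : ℝ)
      = 2 * (parityTriples ℓ
        + 2 * (#(quads ℓ) - ∑ s ∈ range ℓ, ((ℓ - 3 * (s + 1) : ℕ) : ℝ))) := by
  rw [card_symmDiffPairs_quads_evenPairs, sum_card_completions, card_filter_and_not,
    card_filter_and_not, card_gapTriples_filter_le_left_lt_right,
    card_gapTriples_filter_le_left, card_gapTriples_filter_lt_right,
    card_gapTriples_filter_le_left_eq, card_gapTriples_filter_lt_right_eq,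
    ← card_quads_eq_card_gapTriples, Nat.cast_sum, sum_card_gapTriples_filter_eq, Nat.cast_sum]
  ring

theorem card_symmDiffPairs_evenPairs_quads (ℓ : ℕ) :
    (#(symmDiffPairs (evenPairs ℓ) (evenPairs ℓ) (quads ℓ)) : ℝ)
      = 2 * parityTriples ℓ + ℓ * (ℓ - 1) * (ℓ - 2) / 6 - (ℓ * (ℓ - 2) + (ℓ % 2 : ℕ)) / 4
        - (ℓ * (ℓ - 4) + (ℓ % 4 : ℕ) * (4 - (ℓ % 4 : ℕ))) / 4 := by
  have hdiff : (#{p ∈ parityPairs ℓ ×ˢ parityPairs ℓ | DiffMatched p.1 p.2} : ℝ)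
      = ∑ s ∈ range ℓ, ((ℓ - 2 * (s + 1) : ℕ) : ℝ) ^ 2
        - ∑ s ∈ range ℓ, ((ℓ - 2 * (s + 1) : ℕ) : ℝ)
        - 2 * ∑ s ∈ range ℓ, ((ℓ - 4 * (s + 1) : ℕ) : ℝ) := by
    rw [card_parityPairs_diffMatched, mul_sum, ← sum_sub_distrib, ← sum_sub_distrib]
    exact sum_congr rfl fun s _ => by ring
  rw [card_symmDiffPairs_evenPairs_quads_eq_add, Nat.cast_add, card_parityPairs_sumMatched, hdiff,
    sum_range_tsub_two_mul_sq, sum_range_tsub_two_mul, sum_range_tsub_mul four_pos]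
  push_cast
  ring

theorem sum_range_tsub_two_mul_mul_tsub (n : ℕ) :
    ∑ s ∈ range n, ((n - 2 * (s + 1) : ℕ) : ℝ) * ((n - (s + 1) : ℕ) - 2)
      = n * (n - 1) * (n - 2) / 12 + (n / 2 - 2) * ((n * (n - 2) + (n % 2 : ℕ)) / 4) := by
  have hterm : ∀ s ∈ range n, ((n - 2 * (s + 1) : ℕ) : ℝ) * ((n - (s + 1) : ℕ) - 2)
      = ((n - 2 * (s + 1) : ℕ) : ℝ) ^ 2 / 2 + (n / 2 - 2) * (n - 2 * (s + 1) : ℕ) := by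
    intro s _
    rcases le_total n (2 * (s + 1)) with h | h
    · simp [Nat.sub_eq_zero_of_le h]
    · rw [Nat.cast_sub h, Nat.cast_sub (by omega)]
      push_cast
      ring
  rw [sum_congr rfl hterm, sum_add_distrib, ← sum_div, ← mul_sum, sum_range_tsub_two_mul_sq,
    sum_range_tsub_two_mul]
  ring

theorem card_symmDiffPairs_quads (ℓ : ℕ) :
    (#(symmDiffPairs (quads ℓ) (quads ℓ) (quads ℓ)) : ℝ)
      = (ℓ ^ 4 - 10 * ℓ ^ 3 + 32 * ℓ ^ 2 - 32 * ℓ - (ℓ % 2 : ℕ) * (6 * ℓ - 15)) / 16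
        + ℓ * (ℓ - 1) * (ℓ - 2) * (ℓ - 3) / 4
        - (ℓ * (ℓ - 1) * (ℓ - 2) / 2 + (ℓ / 2 - 2) * (3 * (ℓ * (ℓ - 2) + (ℓ % 2 : ℕ)) / 2))
        + 6 * ∑ s ∈ range ℓ, ((ℓ - 3 * (s + 1) : ℕ) : ℝ) := by
  have hdiff : (#(triangles DiffMatched (pairs ℓ)) : ℝ)
      = ∑ s ∈ range ℓ, ((ℓ - (s + 1) : ℕ) : ℝ) * ((ℓ - (s + 1) : ℕ) - 1) * ((ℓ - (s + 1) : ℕ) - 2)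
        - 6 * ∑ s ∈ range ℓ, ((ℓ - 2 * (s + 1) : ℕ) : ℝ) * ((ℓ - (s + 1) : ℕ) - 2)
        + 6 * ∑ s ∈ range ℓ, ((ℓ - 3 * (s + 1) : ℕ) : ℝ) := by
    rw [card_triangles_diffMatched, mul_sum, mul_sum, ← sum_sub_distrib, ← sum_add_distrib]
    exact sum_congr rfl fun s _ => by ring
  rw [card_symmDiffPairs_quads_eq_add, Nat.cast_add, card_triangles_sumMatched, hdiff,
    sum_range_tsub_descFactorial, sum_range_tsub_two_mul_mul_tsub]
  ring

/-! ### Moments -/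

theorem centralMoment_of_affine {ℓ : ℕ} {v w : (ℤ → ℂ) → ℝ} {a c : ℝ}
    (h : ∀ f ∈ binarySeqs ℓ, v f = c + a * w f) (p : ℕ) :
    centralMoment p ℓ v = a ^ p * centralMoment p ℓ w := by
  have hmean : expectation ℓ v = c + a * expectation ℓ w := by
    rw [expectation_congr h, expectation_add ℓ fun _ => c, expectation_const,
      expectation_const_mul]
  rw [centralMoment, centralMoment, ← expectation_const_mul, hmean]
  refine expectation_congr fun f hf => ?_
  rw [h f hf, add_sub_add_left_eq_sub, ← mul_sub, mul_pow]

theorem centralMoment_of_expectation_eq_zero {ℓ : ℕ} {v : (ℤ → ℂ) → ℝ}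
    (h : expectation ℓ v = 0) (p : ℕ) :
    centralMoment p ℓ v = expectation ℓ fun f => v f ^ p := by
  simp only [centralMoment, h, sub_zero]

theorem centralMoment_ADF {ℓ : ℕ} (hℓ : 0 < ℓ) (p : ℕ) :
    centralMoment p ℓ ADF = centralMoment p ℓ ssac / (ℓ : ℝ) ^ (2 * p) := by
  have haffine : ∀ f ∈ binarySeqs ℓ, ADF f = -1 + ((ℓ : ℝ) ^ 2)⁻¹ * ssac f := by
    intro f hf
    rw [ADF_eq hf]
    field_simp
    ring
  rw [centralMoment_of_affine haffine, inv_pow, ← pow_mul, div_eq_inv_mul]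

theorem centralMoment_two_nonneg (ℓ : ℕ) (v : (ℤ → ℂ) → ℝ) : 0 ≤ centralMoment 2 ℓ v :=
  div_nonneg (sum_nonneg fun _ _ => sq_nonneg _) (Nat.cast_nonneg _)

theorem standardizedMoment_ADF {ℓ : ℕ} (hℓ : 0 < ℓ) (p : ℕ) :
    standardizedMoment p ℓ ADF = standardizedMoment p ℓ ssac := by
  have hscale : ((ℓ : ℝ) ^ (2 * 2)) ^ ((p : ℝ) / 2) = (ℓ : ℝ) ^ (2 * p) := by
    rw [← Real.rpow_natCast, ← Real.rpow_mul (Nat.cast_nonneg ℓ), ← Real.rpow_natCast]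
    congr 1
    push_cast
    ring
  rw [standardizedMoment, standardizedMoment, centralMoment_ADF hℓ, centralMoment_ADF hℓ,
    Real.div_rpow (centralMoment_two_nonneg ℓ ssac) (by positivity), hscale,
    div_div_div_cancel_right₀ (by positivity)]

theorem subset_range_of_mem_evenPairs {ℓ : ℕ} {A : Finset ℕ} (hA : A ∈ evenPairs ℓ) :
    A ⊆ range ℓ :=
  (mem_powersetCard.1 (evenPairs_subset_powersetCard ℓ hA)).1

theorem subset_range_of_mem_quads {ℓ : ℕ} {q : Finset ℕ} (hq : q ∈ quads ℓ) : q ⊆ range ℓ :=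
  (mem_powersetCard.1 (quads_subset_powersetCard ℓ hq)).1

theorem disjoint_evenPairs_quads (ℓ : ℕ) : Disjoint (evenPairs ℓ) (quads ℓ) :=
  (pairwise_disjoint_powersetCard (range ℓ) (by norm_num : 2 ≠ 4)).mono
    (evenPairs_subset_powersetCard ℓ) (quads_subset_powersetCard ℓ)

/-- A quarter of the deviation of `ssac` from its mean over `binarySeqs ℓ`. -/
noncomputable def fluctuation (ℓ : ℕ) (f : ℤ → ℂ) : ℝ :=
  walshSum (evenPairs ℓ) f + 2 * walshSum (quads ℓ) f

theorem expectation_fluctuation (ℓ : ℕ) : expectation ℓ (fluctuation ℓ) = 0 := by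
  have hP : ∅ ∉ evenPairs ℓ := fun h => by
    simpa using mem_powersetCard.1 (evenPairs_subset_powersetCard ℓ h)
  have hQ : ∅ ∉ quads ℓ := fun h => by
    simpa using mem_powersetCard.1 (quads_subset_powersetCard ℓ h)
  unfold fluctuation
  rw [expectation_add, expectation_const_mul, expectation_walshSum ℓ hP,
    expectation_walshSum ℓ hQ, mul_zero, add_zero]

theorem centralMoment_ssac (p ℓ : ℕ) :
    centralMoment p ℓ ssac = 4 ^ p * expectation ℓ fun f => fluctuation ℓ f ^ p := by
  rw [centralMoment_of_affine (w := fluctuation ℓ) fun f hf => ssac_eq_add_walshSum hf,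
    centralMoment_of_expectation_eq_zero (expectation_fluctuation ℓ)]

theorem expectation_fluctuation_sq (ℓ : ℕ) :
    expectation ℓ (fun f => fluctuation ℓ f ^ 2) = #(evenPairs ℓ) + 4 * #(quads ℓ) := by
  have hexpand : ∀ f ∈ binarySeqs ℓ, fluctuation ℓ f ^ 2
      = walshSum (evenPairs ℓ) f * walshSum (evenPairs ℓ) f
        + 4 * (walshSum (evenPairs ℓ) f * walshSum (quads ℓ) f)
        + 4 * (walshSum (quads ℓ) f * walshSum (quads ℓ) f) := by
    intro f _
    unfold fluctuation
    ring
  have hP : ∀ A ∈ evenPairs ℓ, A ⊆ range ℓ := fun _ => subset_range_of_mem_evenPairs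
  rw [expectation_congr hexpand, expectation_add, expectation_add, expectation_const_mul,
    expectation_const_mul, expectation_walshSum_mul_walshSum hP,
    expectation_walshSum_mul_walshSum hP,
    expectation_walshSum_mul_walshSum fun _ => subset_range_of_mem_quads,
    disjoint_iff_inter_eq_empty.1 (disjoint_evenPairs_quads ℓ), inter_self, inter_self,
    card_empty, Nat.cast_zero, mul_zero, add_zero]

theorem expectation_fluctuation_pow_three (ℓ : ℕ) :
    expectation ℓ (fun f => fluctuation ℓ f ^ 3)
      = #(symmDiffPairs (evenPairs ℓ) (evenPairs ℓ) (evenPairs ℓ))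
        + 6 * #(symmDiffPairs (evenPairs ℓ) (evenPairs ℓ) (quads ℓ))
        + 12 * #(symmDiffPairs (quads ℓ) (quads ℓ) (evenPairs ℓ))
        + 8 * #(symmDiffPairs (quads ℓ) (quads ℓ) (quads ℓ)) := by
  have hexpand : ∀ f ∈ binarySeqs ℓ, fluctuation ℓ f ^ 3
      = walshSum (evenPairs ℓ) f * walshSum (evenPairs ℓ) f * walshSum (evenPairs ℓ) f
        + 6 * (walshSum (evenPairs ℓ) f * walshSum (evenPairs ℓ) f * walshSum (quads ℓ) f)
        + 12 * (walshSum (quads ℓ) f * walshSum (quads ℓ) f * walshSum (evenPairs ℓ) f)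
        + 8 * (walshSum (quads ℓ) f * walshSum (quads ℓ) f * walshSum (quads ℓ) f) := by
    intro f _
    unfold fluctuation
    ring
  have hP : ∀ A ∈ evenPairs ℓ, A ⊆ range ℓ := fun _ => subset_range_of_mem_evenPairs
  have hQ : ∀ q ∈ quads ℓ, q ⊆ range ℓ := fun _ => subset_range_of_mem_quads
  rw [expectation_congr hexpand, expectation_add, expectation_add, expectation_add,
    expectation_const_mul, expectation_const_mul, expectation_const_mul,
    expectation_walshSum_mul_walshSum_mul_walshSum hP hP,
    expectation_walshSum_mul_walshSum_mul_walshSum hP hP,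
    expectation_walshSum_mul_walshSum_mul_walshSum hQ hQ,
    expectation_walshSum_mul_walshSum_mul_walshSum hQ hQ]

/-- The variance of `ssac` over `binarySeqs ℓ`, divided by `4 / 3`, as a quasi-polynomial
in `ℓ`. -/
noncomputable def varianceQuasiPoly (ℓ : ℕ) : ℝ :=
  4 * (ℓ : ℝ) ^ 3 - 15 * (ℓ : ℝ) ^ 2 + 14 * (ℓ : ℝ) - 3 * (ℓ % 2 : ℕ)

/-- The third central moment of `ssac` over `binarySeqs ℓ`, divided by `16`, as a quasi-polynomial
in `ℓ`. The product `(ℓ % 4) * (4 - ℓ % 4)` takes the values `0, 3, 4, 3` on the residues. -/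
noncomputable def thirdMomentQuasiPoly (ℓ : ℕ) : ℝ :=
  10 * (ℓ : ℝ) ^ 4 - 81 * (ℓ : ℝ) ^ 3 + 206 * (ℓ : ℝ) ^ 2 - 156 * (ℓ : ℝ)
    - 6 * ((ℓ % 4 : ℕ) * (4 - (ℓ % 4 : ℕ))) - (ℓ % 2 : ℕ) * (15 * ℓ - 54)

theorem centralMoment_two_ssac (ℓ : ℕ) :
    centralMoment 2 ℓ ssac = 4 / 3 * varianceQuasiPoly ℓ := by
  rw [centralMoment_ssac, expectation_fluctuation_sq, card_evenPairs, card_quads,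
    varianceQuasiPoly]
  ring

theorem centralMoment_three_ssac (ℓ : ℕ) :
    centralMoment 3 ℓ ssac = 16 * thirdMomentQuasiPoly ℓ := by
  rw [centralMoment_ssac, expectation_fluctuation_pow_three, card_symmDiffPairs_evenPairs,
    card_symmDiffPairs_evenPairs_quads, card_symmDiffPairs_quads_evenPairs_eq,
    card_symmDiffPairs_quads, card_quads, parityTriples, thirdMomentQuasiPoly]
  ring

theorem centralMoment_two_ssac_pos_iff {ℓ : ℕ} (hℓ : 0 < ℓ) :
    0 < centralMoment 2 ℓ ssac ↔ 3 ≤ ℓ := by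
  rw [centralMoment_two_ssac, mul_pos_iff_of_pos_left (by norm_num), varianceQuasiPoly]
  constructor
  · contrapose!
    intro h
    interval_cases ℓ <;> norm_num
  · intro h
    have hε : ((ℓ % 2 : ℕ) : ℝ) ≤ 1 := by
      exact_mod_cast Nat.lt_succ_iff.1 (Nat.mod_lt ℓ two_pos)
    have hℓ' : (3 : ℝ) ≤ ℓ := by exact_mod_cast h
    nlinarith [mul_nonneg (sub_nonneg.2 hℓ') (sub_nonneg.2 hℓ'),
      mul_nonneg (mul_nonneg (sub_nonneg.2 hℓ') (sub_nonneg.2 hℓ')) (sub_nonneg.2 hℓ')]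

theorem centralMoment_two_ADF_pos_iff {ℓ : ℕ} (hℓ : 0 < ℓ) :
    0 < centralMoment 2 ℓ ADF ↔ 3 ≤ ℓ := by
  rw [centralMoment_ADF hℓ, div_pos_iff_of_pos_right (by positivity),
    centralMoment_two_ssac_pos_iff hℓ]

theorem standardizedMoment_three_ssac (ℓ : ℕ) :
    standardizedMoment 3 ℓ ssac
      = 6 * √3 * thirdMomentQuasiPoly ℓ / varianceQuasiPoly ℓ ^ (3 / 2 : ℝ) := by
  have hnonneg : 0 ≤ varianceQuasiPoly ℓ := by
    have := centralMoment_two_nonneg ℓ ssac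
    rw [centralMoment_two_ssac] at this
    linarith
  have hsqrt : √3 * √3 = (3 : ℝ) := Real.mul_self_sqrt (by norm_num)
  have hconst : (4 / 3 : ℝ) ^ (3 / 2 : ℝ) = (2 / √3) ^ 3 := by
    have hsq : (4 / 3 : ℝ) = (2 / √3) ^ (2 : ℝ) := by
      rw [Real.rpow_two, div_pow, sq √3, hsqrt]
      norm_num
    rw [hsq, ← Real.rpow_mul (by positivity), ← Real.rpow_natCast]
    norm_num
  have hratio : 16 / (2 / √3) ^ 3 = 6 * √3 := by
    field_simp
    linear_combination 16 * hsqrt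
  rw [standardizedMoment, centralMoment_three_ssac, centralMoment_two_ssac, Nat.cast_ofNat,
    Real.mul_rpow (by norm_num) hnonneg, hconst, mul_div_mul_comm, hratio, mul_div_assoc]

section Residues

variable {ℓ : ℕ}

theorem varianceQuasiPoly_of_even (h : ℓ ≡ 0 [MOD 2]) :
    varianceQuasiPoly ℓ = 4 * (ℓ : ℝ) ^ 3 - 15 * (ℓ : ℝ) ^ 2 + 14 * (ℓ : ℝ) := by
  have h₂ : ℓ % 2 = 0 := h
  rw [varianceQuasiPoly, h₂, Nat.cast_zero, mul_zero, sub_zero]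

theorem varianceQuasiPoly_of_odd (h : ℓ ≡ 1 [MOD 2]) :
    varianceQuasiPoly ℓ = 4 * (ℓ : ℝ) ^ 3 - 15 * (ℓ : ℝ) ^ 2 + 14 * (ℓ : ℝ) - 3 := by
  have h₂ : ℓ % 2 = 1 := h
  rw [varianceQuasiPoly, h₂, Nat.cast_one, mul_one]

theorem thirdMomentQuasiPoly_of_modEq_zero (h : ℓ ≡ 0 [MOD 4]) :
    thirdMomentQuasiPoly ℓ
      = 10 * (ℓ : ℝ) ^ 4 - 81 * (ℓ : ℝ) ^ 3 + 206 * (ℓ : ℝ) ^ 2 - 156 * (ℓ : ℝ) := by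
  have h₄ : ℓ % 4 = 0 := h
  have h₂ : ℓ % 2 = 0 := by omega
  rw [thirdMomentQuasiPoly, h₄, h₂]
  norm_num

theorem thirdMomentQuasiPoly_of_odd (h : ℓ ≡ 1 [MOD 2]) :
    thirdMomentQuasiPoly ℓ
      = 10 * (ℓ : ℝ) ^ 4 - 81 * (ℓ : ℝ) ^ 3 + 206 * (ℓ : ℝ) ^ 2 - 171 * (ℓ : ℝ) + 36 := by
  have h₂ : ℓ % 2 = 1 := h
  rcases (by omega : ℓ % 4 = 1 ∨ ℓ % 4 = 3) with h₄ | h₄ <;>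
    (rw [thirdMomentQuasiPoly, h₄, h₂]; push_cast; ring)

theorem thirdMomentQuasiPoly_of_modEq_two (h : ℓ ≡ 2 [MOD 4]) :
    thirdMomentQuasiPoly ℓ
      = 10 * (ℓ : ℝ) ^ 4 - 81 * (ℓ : ℝ) ^ 3 + 206 * (ℓ : ℝ) ^ 2 - 156 * (ℓ : ℝ) - 24 := by
  have h₄ : ℓ % 4 = 2 := h
  have h₂ : ℓ % 2 = 0 := by omega
  rw [thirdMomentQuasiPoly, h₄, h₂]
  push_cast
  ring

theorem modEq_one_two_of_modEq_four (h : ℓ ≡ 1 [MOD 4] ∨ ℓ ≡ 3 [MOD 4]) : ℓ ≡ 1 [MOD 2] := by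
  have h₄ : ℓ % 4 = 1 ∨ ℓ % 4 = 3 := h
  change ℓ % 2 = 1
  omega

end Residues

end DemeritFactor

open DemeritFactor in
/-- Third central moments and skewness of the sum of squares of the autocorrelations and of the
demerit factor. For `ℓ = 1` and `ℓ = 2` the variances vanish and the skewness formulas read
`0 / 0 = 0 / 0`; the variances are positive exactly for `3 ≤ ℓ`. -/
theorem mainTheorem3 :
    (∀ ℓ : ℕ,
      (ℓ ≡ 0 [MOD 4] →
        centralMoment 3 ℓ ssac =
          160 * (ℓ : ℝ) ^ 4 - 1296 * (ℓ : ℝ) ^ 3 + 3296 * (ℓ : ℝ) ^ 2 - 2496 * (ℓ : ℝ)) ∧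
      (ℓ ≡ 1 [MOD 4] ∨ ℓ ≡ 3 [MOD 4] →
        centralMoment 3 ℓ ssac =
          160 * (ℓ : ℝ) ^ 4 - 1296 * (ℓ : ℝ) ^ 3 + 3296 * (ℓ : ℝ) ^ 2 - 2736 * (ℓ : ℝ) + 576) ∧
      (ℓ ≡ 2 [MOD 4] →
        centralMoment 3 ℓ ssac =
          160 * (ℓ : ℝ) ^ 4 - 1296 * (ℓ : ℝ) ^ 3 + 3296 * (ℓ : ℝ) ^ 2 - 2496 * (ℓ : ℝ) - 384)) ∧
    (∀ ℓ : ℕ, 0 < ℓ →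
      (ℓ ≡ 0 [MOD 4] →
        centralMoment 3 ℓ ADF =
          (160 * (ℓ : ℝ) ^ 4 - 1296 * (ℓ : ℝ) ^ 3 + 3296 * (ℓ : ℝ) ^ 2 - 2496 * (ℓ : ℝ))
            / (ℓ : ℝ) ^ 6) ∧
      (ℓ ≡ 1 [MOD 4] ∨ ℓ ≡ 3 [MOD 4] →
        centralMoment 3 ℓ ADF =
          (160 * (ℓ : ℝ) ^ 4 - 1296 * (ℓ : ℝ) ^ 3 + 3296 * (ℓ : ℝ) ^ 2 - 2736 * (ℓ : ℝ) + 576)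
            / (ℓ : ℝ) ^ 6) ∧
      (ℓ ≡ 2 [MOD 4] →
        centralMoment 3 ℓ ADF =
          (160 * (ℓ : ℝ) ^ 4 - 1296 * (ℓ : ℝ) ^ 3 + 3296 * (ℓ : ℝ) ^ 2 - 2496 * (ℓ : ℝ) - 384)
            / (ℓ : ℝ) ^ 6)) ∧
    (∀ ℓ : ℕ, 0 < ℓ →
      (0 < centralMoment 2 ℓ ADF ↔ 3 ≤ ℓ) ∧
      (0 < centralMoment 2 ℓ ssac ↔ 3 ≤ ℓ) ∧
      standardizedMoment 3 ℓ ADF = standardizedMoment 3 ℓ ssac ∧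
      (ℓ ≡ 0 [MOD 4] →
        standardizedMoment 3 ℓ ADF =
          6 * √3 * (10 * (ℓ : ℝ) ^ 4 - 81 * (ℓ : ℝ) ^ 3 + 206 * (ℓ : ℝ) ^ 2 - 156 * (ℓ : ℝ))
            / (4 * (ℓ : ℝ) ^ 3 - 15 * (ℓ : ℝ) ^ 2 + 14 * (ℓ : ℝ)) ^ (3 / 2 : ℝ)) ∧
      (ℓ ≡ 1 [MOD 4] ∨ ℓ ≡ 3 [MOD 4] →
        standardizedMoment 3 ℓ ADF =
          6 * √3 * (10 * (ℓ : ℝ) ^ 4 - 81 * (ℓ : ℝ) ^ 3 + 206 * (ℓ : ℝ) ^ 2 - 171 * (ℓ : ℝ) + 36)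
            / (4 * (ℓ : ℝ) ^ 3 - 15 * (ℓ : ℝ) ^ 2 + 14 * (ℓ : ℝ) - 3) ^ (3 / 2 : ℝ)) ∧
      (ℓ ≡ 2 [MOD 4] →
        standardizedMoment 3 ℓ ADF =
          6 * √3 * (10 * (ℓ : ℝ) ^ 4 - 81 * (ℓ : ℝ) ^ 3 + 206 * (ℓ : ℝ) ^ 2 - 156 * (ℓ : ℝ) - 24)
            / (4 * (ℓ : ℝ) ^ 3 - 15 * (ℓ : ℝ) ^ 2 + 14 * (ℓ : ℝ)) ^ (3 / 2 : ℝ))) := by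
  refine ⟨fun ℓ => ⟨fun h => ?_, fun h => ?_, fun h => ?_⟩,
    fun ℓ hℓ => ⟨fun h => ?_, fun h => ?_, fun h => ?_⟩,
    fun ℓ hℓ => ⟨centralMoment_two_ADF_pos_iff hℓ, centralMoment_two_ssac_pos_iff hℓ,
      standardizedMoment_ADF hℓ 3, fun h => ?_, fun h => ?_, fun h => ?_⟩⟩
  · rw [centralMoment_three_ssac, thirdMomentQuasiPoly_of_modEq_zero h]; ring
  · rw [centralMoment_three_ssac, thirdMomentQuasiPoly_of_odd (modEq_one_two_of_modEq_four h)]; ring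
  · rw [centralMoment_three_ssac, thirdMomentQuasiPoly_of_modEq_two h]; ring
  · rw [centralMoment_ADF hℓ, centralMoment_three_ssac, thirdMomentQuasiPoly_of_modEq_zero h]; ring
  · rw [centralMoment_ADF hℓ, centralMoment_three_ssac,
      thirdMomentQuasiPoly_of_odd (modEq_one_two_of_modEq_four h)]; ring
  · rw [centralMoment_ADF hℓ, centralMoment_three_ssac, thirdMomentQuasiPoly_of_modEq_two h]; ring
  · rw [standardizedMoment_ADF hℓ, standardizedMoment_three_ssac,
      thirdMomentQuasiPoly_of_modEq_zero h, varianceQuasiPoly_of_even (h.of_dvd ⟨2, rfl⟩)]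
  · have h₂ := modEq_one_two_of_modEq_four h
    rw [standardizedMoment_ADF hℓ, standardizedMoment_three_ssac,
      thirdMomentQuasiPoly_of_odd h₂, varianceQuasiPoly_of_odd h₂]
  · have h₂ : ℓ ≡ 2 [MOD 2] := h.of_dvd ⟨2, rfl⟩
    rw [standardizedMoment_ADF hℓ, standardizedMoment_three_ssac,
      thirdMomentQuasiPoly_of_modEq_two h, varianceQuasiPoly_of_even h₂]
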